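/- Let $0<A_1<A_2$, let $u_0:\mathbb R\to\mathbb R$, and put $m_0:=u_0-u_0''$. For real $\lambda$ with $|\lambda|>1/A_1$ and $j=1,2$ set $l_j(\lambda):=\operatorname{sgn}(\lambda)\sqrt{\lambda^2-A_j^{-2}}$, $$H_j^{-1}(\lambda):=\sqrt{\tfrac12}\,\sqrt{\tfrac{1}{\mathrm i A_jl_j(\lambda)}-1}\begin{pmatrix}\frac{\lambda A_j}{1-\mathrm iA_jl_j(\lambda)}&1\\1&\frac{\lambda A_j}{1-\mathrm iA_jl_j(\lambda)}\end{pmatrix},$$ where the complex square root has branch cut $[0,\infty)$ and $\sqrt{-1}=\mathrm i$. With $\sigma_2=\begin{pmatrix}0&-\mathrm i\\ \mathrm i&0\end{pmatrix}$, $\sigma_3=\begin{pmatrix}1&0\\0&-1\end{pmatrix}$, and with $(-1)^j\infty$ as the base point of integration, put $$\hat W_j(x,\lambda):=\frac{\lambda(m_0(x)-A_j)}{2A_jl_j(\lambda)}\sigma_2+\frac{m_0(x)-A_j}{2\mathrm iA_j^2l_j(\lambda)}\sigma_3,\qquad f_j(x,\lambda):=\mathrm iA_jl_j(\lambda)\Big(\frac1{2A_j}\int_{(-1)^j\infty}^x(m_0(\xi)-A_j)\,d\xi+\frac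 x2\Big).$$ Let $\tilde\Psi_j(\cdot,\lambda):\mathbb R\to\mathbb C^{2\times2}$ be the solution of the Volterra integral equation $$\tilde\Psi_j(x,\lambda)=I+\int_{(-1)^j\infty}^x e^{\frac{\mathrm il_j(\lambda)}2\int_x^\xi m_0(\tau)\,d\tau\,\sigma_3}\,\hat W_j(\xi,\lambda)\,\tilde\Psi_j(\xi,\lambda)\,e^{-\frac{\mathrm il_j(\lambda)}2\int_x^\xi m_0(\tau)\,d\tau\,\sigma_3}\,d\xi\qquad(x\in\mathbb R),$$ the integral being absolutely convergent. Let $\Psi_j:=H_j^{-1}\tilde\Psi_je^{-f_j\sigma_3}$ be the Jost solutions, let the scattering matrix $c(\lambda)$ be determined by $\Psi_1(x,\lambda)=\Psi_2(x,\lambda)c(\lambda)$ for all $x\in\mathbb R$, and let $r(\lambda):=c_{21}(\lambda)/c_{11}(\lambda)$ be the reflection coefficient. 1. Assume that $u_0\in C^4(\mathbb R)$, that $m_0>0$ on $\mathbb R$, and that $x^n(m_0-A_1)\in L^1(\mathbb R_-)$, $x^n(m_0-A_2)\in L^1(\mathbb R_+)$ and $x^n\frac{d^lm_0}{dx^l}\in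 L^1(\mathbb R)$ for $n=0,1,2$ and $l=1,2$. Then for every real $\lambda$ with $|\lambda|>1/A_1$ the solutions $\tilde\Psi_1,\tilde\Psi_2$ and the matrix $c(\lambda)$ exist and are unique and $c_{11}(\lambda)\ne0$, so that $r(\lambda)$ is well defined, and $r(\lambda)=O(\lambda^{-2})$ as $\lambda\to\pm\infty$. 2. Assume that $u_0\in C^5(\mathbb R)$, that $m_0>0$ on $\mathbb R$, and that $x^n(m_0-A_1)\in L^1(\mathbb R_-)$, $x^n(m_0-A_2)\in L^1(\mathbb R_+)$ and $x^n\frac{d^lm_0}{dx^l}\in L^1(\mathbb R)$ for $n=0,1,2,3$ and $l=1,2,3$. Then, likewise, $r(\lambda)$ is well defined for every real $\lambda$ with $|\lambda|>1/A_1$, and $r(\lambda)=O(\lambda^{-3})$ as $\lambda\to\pm\infty$. -/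

import Mathlib

open MeasureTheory

namespace MCH

noncomputable section

/-- The momentum `m = u - u''`. -/
def momentum (u : ℝ → ℝ) (x : ℝ) : ℝ := u x - iteratedDeriv 2 u x

/-- Step-like initial data with `N + 2` derivatives, positive momentum, and moments of order
at most `N` of `m - A₁` on the left half-line, of `m - A₂` on the right half-line, and of the
derivatives of `m` of orders `1, …, N` on the whole line. -/
structure StepLikeData (A₁ A₂ : ℝ) (N : ℕ) (u : ℝ → ℝ) : Prop where
  contDiff : ContDiff ℝ (N + 2 : ℕ) u
  momentum_pos : ∀ x, 0 < momentum u x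
  moment_left : ∀ n ≤ N,
    IntegrableOn (fun x => x ^ n * (momentum u x - A₁)) (Set.Iio 0)
  moment_right : ∀ n ≤ N,
    IntegrableOn (fun x => x ^ n * (momentum u x - A₂)) (Set.Ioi 0)
  moment_deriv : ∀ n ≤ N, ∀ l, 1 ≤ l → l ≤ N →
    Integrable (fun x => x ^ n * iteratedDeriv l (momentum u) x)

/-- The second Pauli matrix. -/
def sigma2 : Matrix (Fin 2) (Fin 2) ℂ := !![0, -Complex.I; Complex.I, 0]

/-- The third Pauli matrix. -/
def sigma3 : Matrix (Fin 2) (Fin 2) ℂ := !![1, 0; 0, -1]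

/-- The matrix exponential `exp (z σ₃)`. -/
def expSigma3 (z : ℂ) : Matrix (Fin 2) (Fin 2) ℂ :=
  !![Complex.exp z, 0; 0, Complex.exp (-z)]

/-- The square root `l(lam) = √(lam² - A⁻²)` with branch cut `[-1/A, 1/A]` and `l(lam) ∼ lam` at
infinity, for real `lam` with `1/A < |lam|`. -/
def root (A lam : ℝ) : ℝ := Real.sign lam * √(lam ^ 2 - 1 / A ^ 2)

/-- The square root on `ℂ` with branch cut `[0, ∞)` and value `i` at `-1`. -/
def sqrtCut (z : ℂ) : ℂ := Complex.I * (-z) ^ (1 / 2 : ℂ)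

/-- The matrix `H⁻¹` whose columns are the eigenvectors of the `x`-part of the Lax pair on the
constant background `m = A`. -/
def HInv (A lam : ℝ) : Matrix (Fin 2) (Fin 2) ℂ :=
  ((√(1 / 2) : ℝ) * sqrtCut (1 / (Complex.I * A * root A lam) - 1)) •
    !![lam * A / (1 - Complex.I * A * root A lam), 1;
       1, lam * A / (1 - Complex.I * A * root A lam)]

/-- The two spatial infinities: `left` is `-∞` and `right` is `+∞`. -/
inductive Side
  | left
  | right

/-- The part of the line between the given infinity and `x`. -/
def halfLine : Side → ℝ → Set ℝ
  | .left, x => Set.Iic x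
  | .right, x => Set.Ioi x

/-- The integral from the given infinity to `x`: `∫_{-∞}^x g`, respectively
`∫_{+∞}^x g = -∫_x^{+∞} g`. -/
def integralFrom (s : Side) (g : ℝ → ℂ) (x : ℝ) : ℂ :=
  match s with
  | .left => ∫ ξ in halfLine .left x, g ξ
  | .right => -∫ ξ in halfLine .right x, g ξ

/-- The coefficient `Ŵ` of the gauge-transformed `x`-equation. -/
def W (A : ℝ) (m : ℝ → ℝ) (lam x : ℝ) : Matrix (Fin 2) (Fin 2) ℂ :=
  (lam * (m x - A) / (2 * A * root A lam) : ℂ) • sigma2 +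
    ((m x - A) / (2 * Complex.I * A ^ 2 * root A lam) : ℂ) • sigma3

/-- The integrand of the Volterra equation. -/
def volterraIntegrand (A : ℝ) (m : ℝ → ℝ) (lam : ℝ) (Ψ : ℝ → Matrix (Fin 2) (Fin 2) ℂ)
    (x ξ : ℝ) : Matrix (Fin 2) (Fin 2) ℂ :=
  expSigma3 (Complex.I * root A lam / 2 * ((∫ τ in x..ξ, m τ : ℝ) : ℂ)) * W A m lam ξ * Ψ ξ *
    expSigma3 (-(Complex.I * root A lam / 2 * ((∫ τ in x..ξ, m τ : ℝ) : ℂ)))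

/-- `Ψ` solves the Volterra integral equation normalized to `I` at the given infinity. -/
def IsModifiedJost (s : Side) (A : ℝ) (m : ℝ → ℝ) (lam : ℝ)
    (Ψ : ℝ → Matrix (Fin 2) (Fin 2) ℂ) : Prop :=
  ∀ x : ℝ, ∀ i k : Fin 2,
    IntegrableOn (fun ξ => volterraIntegrand A m lam Ψ x ξ i k) (halfLine s x) ∧
    Ψ x i k = (1 : Matrix (Fin 2) (Fin 2) ℂ) i k +
      integralFrom s (fun ξ => volterraIntegrand A m lam Ψ x ξ i k) x

/-- The solution `Ψ̃` of the Volterra equation. -/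
def modifiedJost (s : Side) (A : ℝ) (m : ℝ → ℝ) (lam : ℝ) : ℝ → Matrix (Fin 2) (Fin 2) ℂ :=
  Classical.epsilon (IsModifiedJost s A m lam)

/-- The phase `f` at time zero, normalized at the given infinity. -/
def phase (s : Side) (A : ℝ) (m : ℝ → ℝ) (lam x : ℝ) : ℂ :=
  Complex.I * A * root A lam *
    (1 / (2 * A) * integralFrom s (fun ξ => ((m ξ - A : ℝ) : ℂ)) x + x / 2)

/-- The Jost solution `Ψ = H⁻¹ Ψ̃ exp (-f σ₃)` of the `x`-equation of the Lax pair. -/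
def jost (s : Side) (A : ℝ) (m : ℝ → ℝ) (lam x : ℝ) : Matrix (Fin 2) (Fin 2) ℂ :=
  HInv A lam * modifiedJost s A m lam x * expSigma3 (-phase s A m lam x)

/-- `c` relates the left and the right Jost solutions: `Ψ₁ = Ψ₂ c`. -/
def IsScatteringMatrix (A₁ A₂ : ℝ) (m : ℝ → ℝ) (lam : ℝ) (c : Matrix (Fin 2) (Fin 2) ℂ) : Prop :=
  ∀ x, jost .left A₁ m lam x = jost .right A₂ m lam x * c

/-- The scattering matrix `c(lam)`. -/
def scatteringMatrix (A₁ A₂ : ℝ) (m : ℝ → ℝ) (lam : ℝ) : Matrix (Fin 2) (Fin 2) ℂ :=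
  Classical.epsilon (IsScatteringMatrix A₁ A₂ m lam)

/-- The reflection coefficient `r(lam) = c₂₁(lam) / c₁₁(lam)`, for `1/A₁ < |lam|`. -/
def reflectionCoefficient (A₁ A₂ : ℝ) (m : ℝ → ℝ) (lam : ℝ) : ℂ :=
  scatteringMatrix A₁ A₂ m lam 1 0 / scatteringMatrix A₁ A₂ m lam 0 0

/-- All the objects that enter the definition of `r(lam)` exist and are unique, and the
denominator `c₁₁(lam)` does not vanish. -/
structure ReflectionDefinedAt (A₁ A₂ : ℝ) (m : ℝ → ℝ) (lam : ℝ) : Prop where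
  left : ∃! Ψ, IsModifiedJost .left A₁ m lam Ψ
  right : ∃! Ψ, IsModifiedJost .right A₂ m lam Ψ
  scattering : ∃! c, IsScatteringMatrix A₁ A₂ m lam c
  ne_zero : scatteringMatrix A₁ A₂ m lam 0 0 ≠ 0

end

end MCH

/-! ### Linear differential equations with data prescribed at infinity. -/

namespace MCH

open Set Filter Topology

section Primitive

variable {E : Type*} [NormedAddCommGroup E] [NormedSpace ℝ E]

/-! For real `lam` beyond the branch points, the Lax equation v' = (-v + λmw)/2, w' = (-λmv + w)/2
has real, trace-free coefficients, and all phases are purely imaginary.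

Well-posedness. The Volterra equation is equivalent to a linear differential equation with limit I
at the base point (`isModifiedJost_iff`). A contraction argument gives existence; constancy of
Wronskians gives uniqueness, determinant one, and the scattering matrix by Cramer's rule. Realness
makes Im(v w̄) a conserved quantity, and in the eigenbasis of any constant background it is half the
difference of the squared moduli of the two coordinates. Comparing the two infinities yields |c₁₁|²
= 1 + |c₂₁|² (`norm_scatteringMatrix_sq`). Hence c₁₁ ≠ 0 and |r| ≤ |c₂₁|, so it remains to show that
c₂₁ decays.

Decay. Expand the first column of Ψ₁ in the eigenvectors belonging to the local value m(x). With a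
the `eigenRatio` at m(x), the coordinates Y = av - w and Z = aw - v rotate with opposite phases and
are coupled by s = m'/(2λ(m² - λ⁻²)) = O(1/λ). Moreover Z → 0 at -∞, and |Z| tends to |c₂₁| at +∞ up
to a bounded factor. The drive sY in the equation for Z oscillates fast relative to Z, so it is
removed by passing to T = Z + gY with g vanishing at both ends: T' = qT + e, where e = (s + g' -
iλ√(m² - λ⁻²) g)Y + gsZ. Solving for g in powers of 1/λ gives g = -(i/2)λ⁻²p - (1/2)λ⁻³p'/m with p =
m'/m³. The first term leaves an error O(λ⁻²) in L¹, both together leave O(λ⁻³), and each further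
term costs one more derivative of m. Gronwall's inequality, in which only Re q counts, transfers the
bound to c₂₁ (`Profile.norm_reflectionCoefficient_le`). -/

theorem setIntegral_Iic_eq_add {g : ℝ → E} (hi : ∀ x, IntegrableOn g (Iic x)) (a x : ℝ) :
    ∫ ξ in Iic x, g ξ = (∫ ξ in Iic a, g ξ) + ∫ ξ in a..x, g ξ := by
  rw [← intervalIntegral.integral_Iic_sub_Iic (hi a) (hi x)]; abel

theorem setIntegral_Ioi_eq_sub {g : ℝ → E} (hi : ∀ x, IntegrableOn g (Ioi x)) (a x : ℝ) :
    ∫ ξ in Ioi x, g ξ = (∫ ξ in Ioi a, g ξ) - ∫ ξ in a..x, g ξ := by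
  rw [← intervalIntegral.integral_Ioi_sub_Ioi' (hi a) (hi x)]; abel

variable [CompleteSpace E]

theorem hasDerivAt_setIntegral_Iic {g : ℝ → E} (hg : Continuous g)
    (hi : ∀ x, IntegrableOn g (Iic x)) (x : ℝ) :
    HasDerivAt (fun x => ∫ ξ in Iic x, g ξ) (g x) x := by
  simp_rw [funext (setIntegral_Iic_eq_add hi 0)]
  exact (intervalIntegral.integral_hasDerivAt_right (hg.intervalIntegrable _ _)
    (hg.stronglyMeasurableAtFilter _ _) hg.continuousAt).const_add _

end Primitive

section Existence

variable {E : Type*} [NormedAddCommGroup E] [NormedSpace ℝ E] [CompleteSpace E]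

/-- An ordinary differential equation whose Lipschitz constant is integrable near `-∞` has a
solution with prescribed limit at `-∞`. -/
theorem exists_hasDerivAt_tendsto_atBot {F : ℝ → E → E} {k : ℝ → ℝ}
    (hF : Continuous fun p : ℝ × E => F p.1 p.2) (hk : Continuous k) (hk0 : ∀ x, 0 ≤ k x)
    (hki : ∀ x, IntegrableOn k (Iic x)) (hL : ∀ x y z, ‖F x y - F x z‖ ≤ k x * ‖y - z‖)
    (hF0 : ∀ x, F x 0 = 0) (e : E) :
    ∃ y : ℝ → E, (∀ x, HasDerivAt y (F x (y x)) x) ∧ Tendsto y atBot (𝓝 e) := by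
  set S : ℝ → ℝ := fun x => ∫ ξ in Iic x, k ξ with hS
  have hSd : ∀ x, HasDerivAt S (k x) x := hasDerivAt_setIntegral_Iic hk hki
  have hSc : Continuous S := continuous_iff_continuousAt.2 fun x => (hSd x).continuousAt
  have hSm : Monotone S := monotone_of_deriv_nonneg (fun x => (hSd x).differentiableAt)
    fun x => by rw [(hSd x).deriv]; exact hk0 x
  have hS0 : ∀ x, 0 ≤ S x := fun x => integral_nonneg hk0
  have hSlim : Tendsto S atBot (𝓝 0) := tendsto_integral_Iic_zero (f := k) tendsto_id
  -- The fixed point is sought for exp(-2S)·y in the sup norm. Since the integral of k·exp(2S) is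
  -- (exp(2S) - 1)/2, the integral operator is a 1/2-contraction on the whole line, however large
  -- the integral of `k` is.
  set ρ : ℝ → ℝ := fun x => k x * Real.exp (2 * S x) with hρ
  have hρc : Continuous ρ := by fun_prop
  have hρi : ∀ x, IntegrableOn ρ (Iic x) := fun x => by
    refine ((hki x).mul_const (Real.exp (2 * S x))).mono' hρc.aestronglyMeasurable ?_
    filter_upwards [ae_restrict_mem measurableSet_Iic] with ξ hξ
    rw [Real.norm_of_nonneg (mul_nonneg (hk0 _) (Real.exp_pos _).le)]
    have := hSm hξ
    exact mul_le_mul_of_nonneg_left (Real.exp_le_exp.2 (by linarith)) (hk0 _)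
  have hρint : ∀ x, ∫ ξ in Iic x, ρ ξ = (Real.exp (2 * S x) - 1) / 2 := fun x => by
    rw [integral_Iic_of_hasDerivAt_of_tendsto' (f := fun x => Real.exp (2 * S x) / 2) (m := 1 / 2)
      (fun ξ _ => by
        have := (((hSd ξ).const_mul 2).exp).div_const 2
        exact this.congr_deriv (by simp only [hρ]; ring)) (hρi x)
      (by
        have := ((Real.continuous_exp.tendsto _).comp (hSlim.const_mul 2)).div_const 2
        simpa using this)]
    ring
  have hFn : ∀ x y, ‖F x y‖ ≤ k x * ‖y‖ := fun x y => by simpa [hF0] using hL x y 0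
  have hw : ∀ x : ℝ, ‖Real.exp (2 * S x)‖ = Real.exp (2 * S x) := fun x =>
    Real.norm_of_nonneg (Real.exp_pos _).le
  have hGc : ∀ Z : BoundedContinuousFunction ℝ E,
      Continuous fun ξ => F ξ (Real.exp (2 * S ξ) • Z ξ) := fun Z =>
    hF.comp (continuous_id.prodMk ((by fun_prop : Continuous fun ξ => Real.exp (2 * S ξ)).smul
      Z.continuous))
  have hGi : ∀ (Z : BoundedContinuousFunction ℝ E) x,
      IntegrableOn (fun ξ => F ξ (Real.exp (2 * S ξ) • Z ξ)) (Iic x) := fun Z x => by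
    refine ((hρi x).mul_const ‖Z‖).mono' (hGc Z).aestronglyMeasurable (ae_of_all _ fun ξ => ?_)
    refine (hFn _ _).trans ?_
    rw [norm_smul, hw, ← mul_assoc]
    exact mul_le_mul_of_nonneg_left (Z.norm_coe_le_norm ξ)
      (mul_nonneg (hk0 _) (Real.exp_pos _).le)
  set T : BoundedContinuousFunction ℝ E → ℝ → E := fun Z x =>
    Real.exp (-(2 * S x)) • (e + ∫ ξ in Iic x, F ξ (Real.exp (2 * S ξ) • Z ξ)) with hT
  have hdiff : ∀ Z Z' x, ‖T Z x - T Z' x‖ ≤ 1 / 2 * ‖Z - Z'‖ := fun Z Z' x => by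
    have h1 : T Z x - T Z' x = Real.exp (-(2 * S x)) • ∫ ξ in Iic x,
        (F ξ (Real.exp (2 * S ξ) • Z ξ) - F ξ (Real.exp (2 * S ξ) • Z' ξ)) := by
      rw [integral_sub (hGi Z x) (hGi Z' x), hT]
      simp only [← smul_sub]; congr 1; abel
    have h2 : ‖∫ ξ in Iic x,
        (F ξ (Real.exp (2 * S ξ) • Z ξ) - F ξ (Real.exp (2 * S ξ) • Z' ξ))‖ ≤
        ∫ ξ in Iic x, ρ ξ * ‖Z - Z'‖ := by
      refine norm_integral_le_of_norm_le ((hρi x).mul_const _) (ae_of_all _ fun ξ => ?_)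
      refine (hL _ _ _).trans ?_
      rw [← smul_sub, norm_smul, hw, ← mul_assoc]
      exact mul_le_mul_of_nonneg_left ((Z - Z').norm_coe_le_norm ξ)
        (mul_nonneg (hk0 _) (Real.exp_pos _).le)
    rw [integral_mul_const, hρint] at h2
    rw [h1, norm_smul, Real.norm_of_nonneg (Real.exp_pos _).le]
    refine (mul_le_mul_of_nonneg_left h2 (Real.exp_pos _).le).trans ?_
    have h3 : Real.exp (-(2 * S x)) * Real.exp (2 * S x) = 1 := by
      rw [← Real.exp_add]; simp
    have h4 := Real.exp_pos (-(2 * S x))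
    have h5 : Real.exp (-(2 * S x)) * ((Real.exp (2 * S x) - 1) / 2 * ‖Z - Z'‖) =
      (1 - Real.exp (-(2 * S x))) / 2 * ‖Z - Z'‖ := by linear_combination (‖Z - Z'‖ / 2) * h3
    rw [h5]
    exact mul_le_mul_of_nonneg_right (by linarith) (norm_nonneg _)
  have hTc : ∀ Z, Continuous (T Z) := fun Z => by
    have : Continuous fun x => ∫ ξ in Iic x, F ξ (Real.exp (2 * S ξ) • Z ξ) :=
      continuous_iff_continuousAt.2 fun x =>
        (hasDerivAt_setIntegral_Iic (hGc Z) (hGi Z) x).continuousAt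
    exact (by fun_prop : Continuous fun x => Real.exp (-(2 * S x))).smul (continuous_const.add this)
  have hT0 : ∀ x, ‖T 0 x‖ ≤ ‖e‖ := fun x => by
    simp only [hT, BoundedContinuousFunction.coe_zero, Pi.zero_apply, smul_zero, hF0,
      integral_zero, add_zero, norm_smul, Real.norm_of_nonneg (Real.exp_pos _).le]
    refine mul_le_of_le_one_left (norm_nonneg _) (Real.exp_le_one_iff.2 ?_)
    have := hS0 x
    linarith
  set TT : BoundedContinuousFunction ℝ E → BoundedContinuousFunction ℝ E := fun Z =>
    BoundedContinuousFunction.ofNormedAddCommGroup (T Z) (hTc Z) (1 / 2 * ‖Z - 0‖ + ‖e‖)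
      fun x => by
        have := norm_add_le (T Z x - T 0 x) (T 0 x)
        rw [sub_add_cancel] at this
        exact this.trans (add_le_add (hdiff Z 0 x) (hT0 x)) with hTT
  have hcontr : ContractingWith (1 / 2) TT := by
    refine ⟨by rw [← NNReal.coe_lt_coe]; norm_num, LipschitzWith.of_dist_le_mul fun Z Z' => ?_⟩
    rw [BoundedContinuousFunction.dist_le (by positivity)]
    intro x
    rw [dist_eq_norm, dist_eq_norm]
    exact (hdiff Z Z' x).trans_eq (by simp)
  set Z := ContractingWith.fixedPoint TT hcontr
  have hZ : ∀ x, Real.exp (2 * S x) • Z x =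
      e + ∫ ξ in Iic x, F ξ (Real.exp (2 * S ξ) • Z ξ) := fun x => by
    have h1 : Z x = T Z x := (congrArg (fun f => f x) hcontr.fixedPoint_isFixedPt.eq).symm
    conv_lhs => rw [h1]
    simp only [hT]
    rw [smul_smul, ← Real.exp_add]; simp
  refine ⟨fun x => Real.exp (2 * S x) • Z x, fun x => ?_, ?_⟩
  · exact ((hasDerivAt_setIntegral_Iic (hGc Z) (hGi Z) x).const_add e).congr_of_eventuallyEq
      (Eventually.of_forall hZ)
  · rw [funext hZ]
    simpa using (tendsto_integral_Iic_zero (f := fun ξ => F ξ (Real.exp (2 * S ξ) • Z ξ))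
      tendsto_id (μ := volume)).const_add e

/-- Reflection `x ↦ -x` reduces this to the case of -∞. -/
theorem exists_hasDerivAt_tendsto_atTop {F : ℝ → E → E} {k : ℝ → ℝ}
    (hF : Continuous fun p : ℝ × E => F p.1 p.2) (hk : Continuous k) (hk0 : ∀ x, 0 ≤ k x)
    (hki : ∀ x, IntegrableOn k (Ioi x)) (hL : ∀ x y z, ‖F x y - F x z‖ ≤ k x * ‖y - z‖)
    (hF0 : ∀ x, F x 0 = 0) (e : E) :
    ∃ y : ℝ → E, (∀ x, HasDerivAt y (F x (y x)) x) ∧ Tendsto y atTop (𝓝 e) := by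
  obtain ⟨y, hy, hlim⟩ := exists_hasDerivAt_tendsto_atBot (F := fun x v => -F (-x) v)
    (k := fun x => k (-x)) (by fun_prop) (by fun_prop) (fun x => hk0 _)
    (fun x => by
      have := (hki (-x)).comp_neg_Iio
      exact (integrableOn_Iic_iff_integrableOn_Iio (by simp)).2 this)
    (fun x y z => by
      rw [neg_sub_neg, norm_sub_rev]; exact hL _ _ _) (fun x => by simp [hF0]) e
  refine ⟨fun x => y (-x), fun x => ?_, hlim.comp tendsto_neg_atTop_atBot⟩
  simpa [Function.comp_def] using (hy (-x)).scomp x (hasDerivAt_neg x)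

end Existence

end MCH

/-! ### The Volterra equation as a differential equation. -/

namespace MCH

open Set Filter Topology

noncomputable section

/-- The neighbourhoods of a spatial infinity. -/
def Side.filter : Side → Filter ℝ
  | .left => atBot
  | .right => atTop

instance (s : Side) : s.filter.NeBot := by
  cases s
  · exact inferInstanceAs (NeBot (atBot : Filter ℝ))
  · exact inferInstanceAs (NeBot (atTop : Filter ℝ))

theorem measurableSet_halfLine (s : Side) (x : ℝ) : MeasurableSet (halfLine s x) := by
  cases s
  · exact measurableSet_Iic
  · exact measurableSet_Ioi

theorem intervalIntegrable_of_integrableOn_halfLine {s : Side} {g : ℝ → ℂ}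
    (hi : ∀ x, IntegrableOn g (halfLine s x)) (a b : ℝ) : IntervalIntegrable g volume a b := by
  rw [intervalIntegrable_iff]
  cases s
  · exact (hi (max a b)).mono_set fun x hx => hx.2
  · exact (hi (min a b)).mono_set fun x hx => hx.1

theorem integralFrom_eq_add {s : Side} {g : ℝ → ℂ} (hi : ∀ x, IntegrableOn g (halfLine s x))
    (x : ℝ) : integralFrom s g x = integralFrom s g 0 + ∫ ξ in (0 : ℝ)..x, g ξ := by
  cases s
  · exact setIntegral_Iic_eq_add hi 0 x
  · simp only [integralFrom, halfLine]
    rw [setIntegral_Ioi_eq_sub hi 0 x]; ring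

theorem continuous_integralFrom {s : Side} {g : ℝ → ℂ}
    (hi : ∀ x, IntegrableOn g (halfLine s x)) : Continuous (integralFrom s g) := by
  rw [funext (integralFrom_eq_add hi)]
  exact continuous_const.add
    (intervalIntegral.continuous_primitive (intervalIntegrable_of_integrableOn_halfLine hi) 0)

theorem hasDerivAt_integralFrom {s : Side} {g : ℝ → ℂ} (hg : Continuous g)
    (hi : ∀ x, IntegrableOn g (halfLine s x)) (x : ℝ) :
    HasDerivAt (integralFrom s g) (g x) x := by
  rw [funext (integralFrom_eq_add hi)]
  exact (intervalIntegral.integral_hasDerivAt_right (hg.intervalIntegrable _ _)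
    (hg.stronglyMeasurableAtFilter _ _) hg.continuousAt).const_add _

theorem tendsto_integralFrom (s : Side) (g : ℝ → ℂ) :
    Tendsto (integralFrom s g) s.filter (𝓝 0) := by
  cases s
  · exact tendsto_integral_Iic_zero (f := g) (l := atBot) tendsto_id
  · have := (tendsto_integral_Ioi_zero (f := g) (μ := volume) (l := atTop) tendsto_id).neg
    rwa [neg_zero] at this

theorem eq_add_integralFrom_of_hasDerivAt {s : Side} {f g : ℝ → ℂ} {e : ℂ}
    (hf : ∀ x, HasDerivAt f (g x) x) (hi : ∀ x, IntegrableOn g (halfLine s x))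
    (he : Tendsto f s.filter (𝓝 e)) (x : ℝ) : f x = e + integralFrom s g x := by
  cases s
  · simp only [integralFrom, halfLine]
    rw [integral_Iic_of_hasDerivAt_of_tendsto' (fun x _ => hf x) (hi x) he]; ring
  · simp only [integralFrom, halfLine]
    rw [integral_Ioi_of_hasDerivAt_of_tendsto' (fun x _ => hf x) (hi x) he]; ring

theorem exists_norm_le_of_tendsto {E : Type*} [SeminormedAddCommGroup E] {s : Side}
    {f : ℝ → E} (hf : Continuous f) {e : E}
    (he : Tendsto f s.filter (𝓝 e)) (x : ℝ) : ∃ C, ∀ ξ ∈ halfLine s x, ‖f ξ‖ ≤ C := by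
  have hev : ∀ᶠ ξ in s.filter, ‖f ξ‖ ≤ ‖e‖ + 1 :=
    (he.norm.eventually (gt_mem_nhds (lt_add_one ‖e‖))).mono fun _ h => le_of_lt h
  cases s
  · obtain ⟨b, hb⟩ := eventually_atBot.1 hev
    obtain ⟨C, hC⟩ := isCompact_Icc.exists_bound_of_continuousOn
      (hf.continuousOn (s := Icc b x))
    refine ⟨max (‖e‖ + 1) C, fun ξ hξ => ?_⟩
    rcases le_total ξ b with h | h
    · exact (hb ξ h).trans (le_max_left _ _)
    · exact (hC ξ ⟨h, hξ⟩).trans (le_max_right _ _)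
  · obtain ⟨b, hb⟩ := eventually_atTop.1 hev
    obtain ⟨C, hC⟩ := isCompact_Icc.exists_bound_of_continuousOn
      (hf.continuousOn (s := Icc x b))
    refine ⟨max (‖e‖ + 1) C, fun ξ hξ => ?_⟩
    rcases le_total b ξ with h | h
    · exact (hb ξ h).trans (le_max_left _ _)
    · exact (hC ξ ⟨le_of_lt hξ, h⟩).trans (le_max_right _ _)

theorem exists_hasDerivAt_tendsto {E : Type*} [NormedAddCommGroup E] [NormedSpace ℝ E]
    [CompleteSpace E] (s : Side) {F : ℝ → E → E} {k : ℝ → ℝ}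
    (hF : Continuous fun p : ℝ × E => F p.1 p.2) (hk : Continuous k) (hk0 : ∀ x, 0 ≤ k x)
    (hki : ∀ x, IntegrableOn k (halfLine s x))
    (hL : ∀ x y z, ‖F x y - F x z‖ ≤ k x * ‖y - z‖) (hF0 : ∀ x, F x 0 = 0) (e : E) :
    ∃ y : ℝ → E, (∀ x, HasDerivAt y (F x (y x)) x) ∧ Tendsto y s.filter (𝓝 e) := by
  cases s
  · exact exists_hasDerivAt_tendsto_atBot hF hk hk0 hki hL hF0 e
  · exact exists_hasDerivAt_tendsto_atTop hF hk hk0 hki hL hF0 e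

/-- The diagonal entries of `σ₃`. -/
def sgn3 : Fin 2 → ℂ := ![1, -1]

/-- The rate `i l(lam) m / 2` of the phase. -/
def phaseRate (A : ℝ) (m : ℝ → ℝ) (lam x : ℝ) : ℂ := Complex.I * root A lam / 2 * m x

/-- The entries of conjugation by the matrix exponential of the phase. -/
def gauge (A : ℝ) (m : ℝ → ℝ) (lam : ℝ) (i k : Fin 2) (x : ℝ) : ℂ :=
  Complex.exp ((sgn3 i - sgn3 k) *
    (Complex.I * root A lam / 2 * ((∫ τ in (0 : ℝ)..x, m τ : ℝ) : ℂ)))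

variable {A lam : ℝ} {m : ℝ → ℝ} {s : Side}

theorem gauge_self (i : Fin 2) (x : ℝ) : gauge A m lam i i x = 1 := by simp [gauge]

theorem gauge_mul (i j k : Fin 2) (x : ℝ) :
    gauge A m lam i j x * gauge A m lam j k x = gauge A m lam i k x := by
  simp only [gauge, ← Complex.exp_add]; congr 1; ring

/-- `root` is a real number, so the exponent is purely imaginary and conjugation by the phase
affects neither bounds nor integrability. -/
theorem norm_gauge (i k : Fin 2) (x : ℝ) : ‖gauge A m lam i k x‖ = 1 := by
  rw [gauge, Complex.norm_exp]
  fin_cases i <;> fin_cases k <;> simp [sgn3]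

theorem hasDerivAt_gauge (hm : Continuous m) (i k : Fin 2) (x : ℝ) :
    HasDerivAt (gauge A m lam i k)
      ((sgn3 i - sgn3 k) * phaseRate A m lam x * gauge A m lam i k x) x := by
  have h1 : HasDerivAt (fun x => ∫ τ in (0 : ℝ)..x, m τ) (m x) x :=
    intervalIntegral.integral_hasDerivAt_right (hm.intervalIntegrable _ _)
      (hm.stronglyMeasurableAtFilter _ _) hm.continuousAt
  refine (((h1.ofReal_comp.const_mul (Complex.I * root A lam / 2)).const_mul
    (sgn3 i - sgn3 k)).cexp).congr_deriv ?_
  simp only [gauge, phaseRate]; ring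

theorem continuous_gauge (hm : Continuous m) (i k : Fin 2) : Continuous (gauge A m lam i k) :=
  continuous_iff_continuousAt.2 fun x => (hasDerivAt_gauge hm i k x).continuousAt

/-- An oscillating unimodular factor preserves these limits because it is trivial on the diagonal,
while the off-diagonal limits are zero. -/
theorem tendsto_gauge_mul {f : ℝ → ℂ} {l : Filter ℝ} {i k : Fin 2} (i' k' : Fin 2)
    (hik : i = k → i' = k')
    (hf : Tendsto f l (𝓝 ((1 : Matrix (Fin 2) (Fin 2) ℂ) i k))) :
    Tendsto (fun x => gauge A m lam i' k' x * f x) l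
      (𝓝 ((1 : Matrix (Fin 2) (Fin 2) ℂ) i k)) := by
  by_cases h : i = k
  · rw [hik h]; simpa only [gauge_self, one_mul] using hf
  · rw [Matrix.one_apply_ne h] at hf ⊢
    rw [tendsto_zero_iff_norm_tendsto_zero] at hf ⊢
    simpa only [norm_mul, norm_gauge, one_mul] using hf

theorem expSigma3_conj_apply (z : ℂ) (M : Matrix (Fin 2) (Fin 2) ℂ) (i k : Fin 2) :
    (expSigma3 z * M * expSigma3 (-z)) i k = Complex.exp ((sgn3 i - sgn3 k) * z) * M i k := by
  have h1 : Complex.exp z * Complex.exp (-z) = 1 := by rw [← Complex.exp_add]; simp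
  have h2 : Complex.exp (2 * z) = Complex.exp z * Complex.exp z := by
    rw [← Complex.exp_add, two_mul]
  have h3 : Complex.exp (-(2 * z)) = Complex.exp (-z) * Complex.exp (-z) := by
    rw [← Complex.exp_add]; congr 1; ring
  have h4 : (1 : ℂ) + 1 = 2 := by norm_num
  have h5 : (-1 : ℂ) - 1 = -2 := by norm_num
  rw [Matrix.eta_fin_two M, expSigma3, expSigma3, Matrix.mul_fin_two, Matrix.mul_fin_two]
  fin_cases i <;> fin_cases k <;> simp [sgn3, h4, h5, h2, h3]
  · linear_combination M 0 0 * h1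
  · ring
  · ring
  · linear_combination M 1 1 * h1

/-- Splitting the phase integral at 0 separates `x` from `ξ`, which turns the Volterra integral into
a primitive with a prefactor. -/
theorem volterraIntegrand_apply (hm : Continuous m) (Ψ : ℝ → Matrix (Fin 2) (Fin 2) ℂ)
    (x ξ : ℝ) (i k : Fin 2) :
    volterraIntegrand A m lam Ψ x ξ i k =
      gauge A m lam k i x * (gauge A m lam i k ξ * (W A m lam ξ * Ψ ξ) i k) := by
  rw [volterraIntegrand, Matrix.mul_assoc (expSigma3 _), expSigma3_conj_apply,
    ← mul_assoc (gauge A m lam k i x)]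
  congr 1
  simp only [gauge]
  rw [← Complex.exp_add, ← intervalIntegral.integral_interval_sub_left
    (hm.intervalIntegrable 0 ξ) (hm.intervalIntegrable 0 x)]
  congr 1
  push_cast
  ring

/-- The coefficient of `W` with respect to `m - A`. -/
def WCoeff (A lam : ℝ) : Matrix (Fin 2) (Fin 2) ℂ :=
  (lam / (2 * A * root A lam) : ℂ) • sigma2 + (1 / (2 * Complex.I * A ^ 2 * root A lam) : ℂ) • sigma3

theorem W_eq_smul (x : ℝ) : W A m lam x = ((m x - A : ℝ) : ℂ) • WCoeff A lam := by
  rw [W, WCoeff, smul_add, smul_smul, smul_smul]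
  congr 2 <;> push_cast <;> ring

theorem W_apply (x : ℝ) (i j : Fin 2) :
    W A m lam x i j = ((m x - A : ℝ) : ℂ) * WCoeff A lam i j := by
  rw [W_eq_smul]; rfl

theorem continuous_W_apply (hm : Continuous m) (i j : Fin 2) :
    Continuous fun x => W A m lam x i j := by
  simp only [W_apply]; fun_prop

/-- The differential form of the Volterra equation. -/
structure IsModifiedJostODE (s : Side) (A : ℝ) (m : ℝ → ℝ) (lam : ℝ)
    (Ψ : ℝ → Matrix (Fin 2) (Fin 2) ℂ) : Prop where
  deriv : ∀ x i k, HasDerivAt (fun x => Ψ x i k)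
    ((W A m lam x * Ψ x) i k - (sgn3 i - sgn3 k) * phaseRate A m lam x * Ψ x i k) x
  tendsto : ∀ i k, Tendsto (fun x => Ψ x i k) s.filter
    (𝓝 ((1 : Matrix (Fin 2) (Fin 2) ℂ) i k))

/-- The gauge is an integrating factor for the phase term; the remaining coefficient has the size of
m - A, which is integrable near the base point. -/
theorem hasDerivAt_gauge_mul (hm : Continuous m) {Ψ : ℝ → Matrix (Fin 2) (Fin 2) ℂ} {x : ℝ}
    {i k : Fin 2} (h : HasDerivAt (fun x => Ψ x i k)
      ((W A m lam x * Ψ x) i k - (sgn3 i - sgn3 k) * phaseRate A m lam x * Ψ x i k) x) :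
    HasDerivAt (fun x => gauge A m lam i k x * Ψ x i k)
      (gauge A m lam i k x * (W A m lam x * Ψ x) i k) x := by
  refine ((hasDerivAt_gauge hm i k x).mul h).congr_deriv ?_
  ring

theorem hasDerivAt_of_gauge_mul (hm : Continuous m) {Ψ : ℝ → Matrix (Fin 2) (Fin 2) ℂ} {x : ℝ}
    {i k : Fin 2} (h : HasDerivAt (fun x => gauge A m lam i k x * Ψ x i k)
      (gauge A m lam i k x * (W A m lam x * Ψ x) i k) x) :
    HasDerivAt (fun x => Ψ x i k)
      ((W A m lam x * Ψ x) i k - (sgn3 i - sgn3 k) * phaseRate A m lam x * Ψ x i k) x := by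
  have hg : ∀ x, gauge A m lam k i x * gauge A m lam i k x = 1 := fun x => by
    rw [gauge_mul, gauge_self]
  have h1 := (hasDerivAt_gauge (A := A) (lam := lam) hm k i x).mul h
  refine (h1.congr_deriv ?_).congr_of_eventuallyEq (Eventually.of_forall fun x => ?_)
  · linear_combination ((sgn3 k - sgn3 i) * phaseRate A m lam x * Ψ x i k +
      (W A m lam x * Ψ x) i k) * hg x
  · simp only [Pi.mul_apply]
    linear_combination -(Ψ x i k) * hg x

theorem IsModifiedJostODE.continuous {Ψ : ℝ → Matrix (Fin 2) (Fin 2) ℂ}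
    (h : IsModifiedJostODE s A m lam Ψ) (i k : Fin 2) : Continuous fun x => Ψ x i k :=
  continuous_iff_continuousAt.2 fun x => (h.deriv x i k).continuousAt

/-- After multiplication by the gauge this is the fundamental theorem of calculus with an infinite
base point. -/
theorem isModifiedJost_iff (hm : Continuous m)
    (hmi : ∀ x, IntegrableOn (fun ξ => m ξ - A) (halfLine s x))
    (Ψ : ℝ → Matrix (Fin 2) (Fin 2) ℂ) :
    IsModifiedJost s A m lam Ψ ↔ IsModifiedJostODE s A m lam Ψ := by
  set G : Fin 2 → Fin 2 → ℝ → ℂ := fun i k ξ =>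
    gauge A m lam i k ξ * (W A m lam ξ * Ψ ξ) i k with hG
  have hg : ∀ i k x, gauge A m lam k i x * gauge A m lam i k x = 1 := fun i k x => by
    rw [gauge_mul, gauge_self]
  have hV : ∀ x i k, (fun ξ => volterraIntegrand A m lam Ψ x ξ i k) =
      fun ξ => gauge A m lam k i x * G i k ξ := fun x i k =>
    funext fun ξ => volterraIntegrand_apply hm Ψ x ξ i k
  have hVint : ∀ x i k, integralFrom s (fun ξ => volterraIntegrand A m lam Ψ x ξ i k) x =
      gauge A m lam k i x * integralFrom s (G i k) x := fun x i k => by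
    rw [hV]
    cases s <;> simp only [integralFrom, integral_const_mul]; ring
  have hone : ∀ i k x, gauge A m lam i k x * (1 : Matrix (Fin 2) (Fin 2) ℂ) i k =
      (1 : Matrix (Fin 2) (Fin 2) ℂ) i k := fun i k x => by
    by_cases h : i = k
    · rw [h, gauge_self, one_mul]
    · rw [Matrix.one_apply_ne h, mul_zero]
  have hGcont : (∀ i k, Continuous fun x => Ψ x i k) → ∀ i k, Continuous (G i k) :=
    fun h i k => by
      refine (continuous_gauge hm i k).mul ?_
      simp only [Matrix.mul_apply]
      exact continuous_finsetSum _ fun j _ => (continuous_W_apply hm i j).mul (h j k)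
  constructor
  · intro h
    have hGi : ∀ i k x, IntegrableOn (G i k) (halfLine s x) := fun i k x => by
      have := ((h x i k).1.const_mul (gauge A m lam i k x))
      refine this.congr (ae_of_all _ fun ξ => ?_)
      change gauge A m lam i k x * volterraIntegrand A m lam Ψ x ξ i k = _
      rw [volterraIntegrand_apply hm, ← mul_assoc, hg, one_mul]
    have hY : ∀ i k x, gauge A m lam i k x * Ψ x i k =
        (1 : Matrix (Fin 2) (Fin 2) ℂ) i k + integralFrom s (G i k) x := fun i k x => by
      rw [(h x i k).2, hVint, mul_add, hone, ← mul_assoc, hg, one_mul]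
    have hΨ : ∀ i k x, Ψ x i k = gauge A m lam k i x *
        ((1 : Matrix (Fin 2) (Fin 2) ℂ) i k + integralFrom s (G i k) x) := fun i k x => by
      rw [← hY, ← mul_assoc, hg, one_mul]
    -- Regularity is bootstrapped: integrability of `G` makes its primitive continuous, hence `Ψ`,
    -- hence `G` itself, and only then can the primitive be differentiated.
    have hc : ∀ i k, Continuous fun x => Ψ x i k := fun i k => by
      simp only [hΨ]
      exact (continuous_gauge hm k i).mul
        (continuous_const.add (continuous_integralFrom (hGi i k)))
    refine ⟨fun x i k => hasDerivAt_of_gauge_mul hm ?_, fun i k => ?_⟩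
    · simp only [hY]
      exact (hasDerivAt_integralFrom (hGcont hc i k) (hGi i k) x).const_add _
    · simp only [hΨ]
      refine tendsto_gauge_mul k i (fun h => h.symm) ?_
      simpa using (tendsto_integralFrom s (G i k)).const_add _
  · intro h
    have hGi : ∀ i k x, IntegrableOn (G i k) (halfLine s x) := fun i k x => by
      -- `Ψ` is bounded on the half-line, so `G` is dominated by a multiple of |m - A|.
      choose C hC using fun j => exists_norm_le_of_tendsto (h.continuous j k) (h.tendsto j k) x
      have hint : Integrable (fun ξ => ∑ j, ‖WCoeff A lam i j‖ * C j * ‖m ξ - A‖)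
          (volume.restrict (halfLine s x)) :=
        integrable_finsetSum _ fun j _ => (hmi x).norm.const_mul _
      refine hint.mono' (hGcont h.continuous i k).aestronglyMeasurable ?_
      filter_upwards [ae_restrict_mem (measurableSet_halfLine s x)] with ξ hξ
      rw [hG, norm_mul, norm_gauge, one_mul, Matrix.mul_apply]
      refine (norm_sum_le _ _).trans (Finset.sum_le_sum fun j _ => ?_)
      rw [norm_mul, W_apply, norm_mul, Complex.norm_real]
      calc _ ≤ ‖m ξ - A‖ * ‖WCoeff A lam i j‖ * C j :=
            mul_le_mul_of_nonneg_left (hC j ξ hξ) (by positivity)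
        _ = _ := by ring
    intro x i k
    refine ⟨?_, ?_⟩
    · rw [hV]; exact (hGi i k x).const_mul _
    · have := eq_add_integralFrom_of_hasDerivAt (s := s)
        (fun x => hasDerivAt_gauge_mul hm (h.deriv x i k)) (hGi i k)
        (tendsto_gauge_mul i k id (h.tendsto i k)) x
      rw [hVint]
      calc Ψ x i k = gauge A m lam k i x * (gauge A m lam i k x * Ψ x i k) := by
            rw [← mul_assoc, hg, one_mul]
        _ = _ := by rw [this, mul_add]; congr 1; by_cases hik : i = k
                    · rw [hik, gauge_self, one_mul]
                    · rw [Matrix.one_apply_ne hik, mul_zero]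

/-- The fixed point theorem is applied to the gauged unknown, whose Lipschitz constant is a multiple
of |m - A|; the phase term itself need not be integrable. -/
theorem exists_isModifiedJostODE (hm : Continuous m)
    (hmi : ∀ x, IntegrableOn (fun ξ => m ξ - A) (halfLine s x)) :
    ∃ Ψ, IsModifiedJostODE s A m lam Ψ := by
  set F : ℝ → (Fin 2 → Fin 2 → ℂ) → Fin 2 → Fin 2 → ℂ := fun x Y i k =>
    ∑ j, gauge A m lam i j x * W A m lam x i j * Y j k with hF
  set K : ℝ := ∑ i, ∑ j, ‖WCoeff A lam i j‖ with hK
  obtain ⟨Y, hY, hlim⟩ := exists_hasDerivAt_tendsto s (F := F) (k := fun x => K * ‖m x - A‖)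
    (continuous_pi fun i => continuous_pi fun k => continuous_finsetSum _ fun j _ =>
      (((continuous_gauge hm i j).comp continuous_fst).mul
        ((continuous_W_apply hm i j).comp continuous_fst)).mul (by fun_prop))
    (by fun_prop) (fun x => by positivity) (fun x => (hmi x).norm.const_mul _)
    (fun x y z => by
      refine (pi_norm_le_iff_of_nonneg (by positivity)).2 fun i =>
        (pi_norm_le_iff_of_nonneg (by positivity)).2 fun k => ?_
      simp only [hF, Pi.sub_apply, ← Finset.sum_sub_distrib, ← mul_sub]
      refine (norm_sum_le _ _).trans ?_
      have h1 : ∀ j, ‖gauge A m lam i j x * W A m lam x i j * (y j k - z j k)‖ ≤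
          ‖WCoeff A lam i j‖ * (‖m x - A‖ * ‖y - z‖) := fun j => by
        rw [norm_mul, norm_mul, norm_gauge, one_mul, W_apply, norm_mul, Complex.norm_real,
          mul_comm ‖m x - A‖, mul_assoc]
        have h2 : ‖y j k - z j k‖ ≤ ‖y - z‖ :=
          (norm_le_pi_norm ((y - z) j) k).trans (norm_le_pi_norm (y - z) j)
        gcongr
      refine (Finset.sum_le_sum fun j _ => h1 j).trans ?_
      rw [← Finset.sum_mul, mul_assoc]
      refine mul_le_mul_of_nonneg_right ?_ (by positivity)
      exact Finset.single_le_sum (f := fun i => ∑ j, ‖WCoeff A lam i j‖)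
        (fun i _ => by positivity) (Finset.mem_univ i))
    (fun x => by ext i k; simp [hF]) (fun i k => (1 : Matrix (Fin 2) (Fin 2) ℂ) i k)
  have hg : ∀ i k x, gauge A m lam k i x * gauge A m lam i k x = 1 := fun i k x => by
    rw [gauge_mul, gauge_self]
  set Ψ : ℝ → Matrix (Fin 2) (Fin 2) ℂ := fun x => Matrix.of fun i k =>
    gauge A m lam k i x * Y x i k with hΨ
  have hYΨ : ∀ x i k, gauge A m lam i k x * Ψ x i k = Y x i k := fun x i k => by
    simp only [hΨ, Matrix.of_apply]; rw [← mul_assoc, hg, one_mul]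
  refine ⟨Ψ, fun x i k => hasDerivAt_of_gauge_mul hm ?_, fun i k => ?_⟩
  · simp only [hYΨ]
    refine (hasDerivAt_pi.1 (hasDerivAt_pi.1 (hY x) i) k).congr_deriv ?_
    simp only [hF, Matrix.mul_apply, Finset.mul_sum]
    refine Finset.sum_congr rfl fun j _ => ?_
    rw [← hYΨ, ← gauge_mul i j k]
    ring
  · simp only [hΨ, Matrix.of_apply]
    exact tendsto_gauge_mul k i (fun h => h.symm)
      (tendsto_pi_nhds.1 (tendsto_pi_nhds.1 hlim i) k)

end

end MCH

/-! ### Wronskians, eigenvectors of the constant background, and the Lax equation. -/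

namespace MCH

open Set Filter Topology

noncomputable section

variable {A lam : ℝ} {m : ℝ → ℝ} {s : Side}

section Wronskian

theorem W_trace (x : ℝ) : W A m lam x 0 0 + W A m lam x 1 1 = 0 := by
  simp [W, sigma2, sigma3]

/-- The Wronskians of two solutions of the Volterra equation. -/
theorem IsModifiedJostODE.wronskian (hm : Continuous m) {Φ Ψ : ℝ → Matrix (Fin 2) (Fin 2) ℂ}
    (hΦ : IsModifiedJostODE s A m lam Φ) (hΨ : IsModifiedJostODE s A m lam Ψ) (x : ℝ)
    (k j : Fin 2) : sgn3 k * (Φ x 0 k * Ψ x 1 j - Φ x 1 k * Ψ x 0 j) =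
      (1 : Matrix (Fin 2) (Fin 2) ℂ) k.rev j := by
  set P : ℝ → ℂ := fun x => sgn3 k * (Φ x 0 k * Ψ x 1 j - Φ x 1 k * Ψ x 0 j) with hP
  -- The row phases cancel in the Wronskian and the column phases add up to `sgn3 k + sgn3 j`, which
  -- this gauge removes. What is left is multiplied by the trace of `W`, which is zero.
  have hd : ∀ x, HasDerivAt (fun x => gauge A m lam k.rev j x * P x) 0 x := fun x => by
    refine ((hasDerivAt_gauge hm k.rev j x).mul ((((hΦ.deriv x 0 k).mul (hΨ.deriv x 1 j)).sub
      ((hΦ.deriv x 1 k).mul (hΨ.deriv x 0 j))).const_mul (sgn3 k))).congr_deriv ?_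
    have hr : sgn3 k.rev = - sgn3 k := by fin_cases k <;> simp [sgn3]
    have h0 : sgn3 0 = 1 := rfl
    have h1 : sgn3 1 = -1 := rfl
    simp only [Matrix.mul_apply, Fin.sum_univ_two, hr, h0, h1, Pi.sub_apply, Pi.mul_apply]
    linear_combination gauge A m lam k.rev j x * P x * W_trace (A := A) (m := m) (lam := lam) x
  have hlim : Tendsto (fun x => gauge A m lam k.rev j x * P x) s.filter
      (𝓝 ((1 : Matrix (Fin 2) (Fin 2) ℂ) k.rev j)) := by
    refine tendsto_gauge_mul _ _ id ?_
    have := (((hΦ.tendsto 0 k).mul (hΨ.tendsto 1 j)).sub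
      ((hΦ.tendsto 1 k).mul (hΨ.tendsto 0 j))).const_mul (sgn3 k)
    refine this.trans (le_of_eq (congrArg 𝓝 ?_))
    fin_cases k <;> fin_cases j <;> simp [sgn3, Matrix.one_apply]
  have hconst : ∀ y, gauge A m lam k.rev j y * P y = gauge A m lam k.rev j x * P x := fun y =>
    is_const_of_deriv_eq_zero (fun z => (hd z).differentiableAt) (fun z => (hd z).deriv) y x
  have h := tendsto_nhds_unique (tendsto_const_nhds.congr fun y => (hconst y).symm) hlim
  calc P x = gauge A m lam j k.rev x * (gauge A m lam k.rev j x * P x) := by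
        rw [← mul_assoc, gauge_mul, gauge_self, one_mul]
    _ = _ := by
      rw [h]
      by_cases hk : k.rev = j
      · rw [hk, gauge_self, one_mul]
      · rw [Matrix.one_apply_ne hk, mul_zero]

theorem IsModifiedJostODE.det_eq_one (hm : Continuous m) {Φ : ℝ → Matrix (Fin 2) (Fin 2) ℂ}
    (hΦ : IsModifiedJostODE s A m lam Φ) (x : ℝ) :
    Φ x 0 0 * Φ x 1 1 - Φ x 1 0 * Φ x 0 1 = 1 := by
  simpa [sgn3, Matrix.one_apply] using hΦ.wronskian hm hΦ x 0 1

/-- For J the standard symplectic matrix, the Wronskian identities read ΦᵀJΨ = J and ΨᵀJΨ = J; as Ψ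
is invertible, the two solutions agree. -/
theorem IsModifiedJostODE.unique (hm : Continuous m) {Φ Ψ : ℝ → Matrix (Fin 2) (Fin 2) ℂ}
    (hΦ : IsModifiedJostODE s A m lam Φ) (hΨ : IsModifiedJostODE s A m lam Ψ) : Φ = Ψ := by
  funext x
  have h00 := hΦ.wronskian hm hΨ x 0 0
  have h01 := hΦ.wronskian hm hΨ x 0 1
  have h10 := hΦ.wronskian hm hΨ x 1 0
  have h11 := hΦ.wronskian hm hΨ x 1 1
  have hd := hΨ.det_eq_one hm x
  simp [sgn3, Matrix.one_apply] at h00 h01 h10 h11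
  ext i k
  fin_cases i <;> fin_cases k <;> simp
  · linear_combination -Φ x 0 0 * hd + Ψ x 0 0 * h01 - Ψ x 0 1 * h00
  · linear_combination -Φ x 0 1 * hd + Ψ x 0 1 * h10 - Ψ x 0 0 * h11
  · linear_combination -Φ x 1 0 * hd + Ψ x 1 0 * h01 - Ψ x 1 1 * h00
  · linear_combination -Φ x 1 1 * hd + Ψ x 1 1 * h10 - Ψ x 1 0 * h11

theorem existsUnique_isModifiedJost (hm : Continuous m)
    (hmi : ∀ x, IntegrableOn (fun ξ => m ξ - A) (halfLine s x)) :
    ∃! Ψ, IsModifiedJost s A m lam Ψ := by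
  obtain ⟨Ψ, hΨ⟩ := exists_isModifiedJostODE (lam := lam) hm hmi
  exact ⟨Ψ, (isModifiedJost_iff hm hmi Ψ).2 hΨ, fun Φ hΦ =>
    ((isModifiedJost_iff hm hmi Φ).1 hΦ).unique hm hΨ⟩

theorem isModifiedJostODE_modifiedJost (hm : Continuous m)
    (hmi : ∀ x, IntegrableOn (fun ξ => m ξ - A) (halfLine s x)) :
    IsModifiedJostODE s A m lam (modifiedJost s A m lam) :=
  (isModifiedJost_iff hm hmi _).1
    (Classical.epsilon_spec (existsUnique_isModifiedJost hm hmi).exists)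

end Wronskian

section Eigenvectors

/-- The ratio `(1 / lam + i √(A² - lam⁻²)) / A` of the components of the eigenvectors. -/
def eigenRatio (A lam : ℝ) : ℂ := (1 / lam + Complex.I * √(A ^ 2 - 1 / lam ^ 2)) / A

/-- The normalizing factor of the eigenvectors. -/
def eigenScale (A lam : ℝ) : ℂ := (√(1 / 2) : ℝ) * sqrtCut (1 / (Complex.I * A * root A lam) - 1)

theorem ne_zero_of_lt_abs (hA : 0 < A) (hl : 1 / A < |lam|) : lam ≠ 0 :=
  abs_pos.1 ((one_div_pos.2 hA).trans hl)

theorem inv_sq_lt_sq (hA : 0 < A) (hl : 1 / A < |lam|) : 1 / lam ^ 2 < A ^ 2 := by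
  have h := ne_zero_of_lt_abs hA hl
  rw [div_lt_iff₀ hA] at hl
  rw [div_lt_iff₀ (by positivity), ← sq_abs lam, ← mul_pow, mul_comm]
  exact one_lt_pow₀ hl two_ne_zero

theorem real_sign_mul_abs (x : ℝ) : Real.sign x * |x| = x := by
  rcases lt_trichotomy x 0 with h | h | h
  · rw [Real.sign_of_neg h, abs_of_neg h]; ring
  · simp [h]
  · rw [Real.sign_of_pos h, abs_of_pos h]; ring

/-- Trades the sign in `root` for a factor `lam`. The remaining positive square root stays smooth
when A is replaced by m(x). -/
theorem mul_root_eq (hA : 0 < A) (hl : 1 / A < |lam|) :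
    A * root A lam = lam * √(A ^ 2 - 1 / lam ^ 2) := by
  have h := ne_zero_of_lt_abs hA hl
  have h1 : √(lam ^ 2 - 1 / A ^ 2) = |lam| / A * √(A ^ 2 - 1 / lam ^ 2) := by
    rw [← Real.sqrt_sq (show (0 : ℝ) ≤ |lam| / A by positivity), ← Real.sqrt_mul (sq_nonneg _),
      div_pow, sq_abs]
    congr 1
    field_simp
  calc A * root A lam = Real.sign lam * |lam| * √(A ^ 2 - 1 / lam ^ 2) := by
        rw [root, h1]; field_simp
    _ = _ := by rw [real_sign_mul_abs]

theorem sqrt_pos_of_lt_abs (hA : 0 < A) (hl : 1 / A < |lam|) : 0 < √(A ^ 2 - 1 / lam ^ 2) :=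
  Real.sqrt_pos.2 (sub_pos.2 (inv_sq_lt_sq hA hl))

theorem ofReal_mul_root_eq (hA : 0 < A) (hl : 1 / A < |lam|) :
    (A : ℂ) * root A lam = lam * √(A ^ 2 - 1 / lam ^ 2) := by
  rw [← Complex.ofReal_mul, mul_root_eq hA hl, Complex.ofReal_mul]

theorem ofReal_sqrt_sq (hA : 0 < A) (hl : 1 / A < |lam|) :
    ((√(A ^ 2 - 1 / lam ^ 2) : ℝ) : ℂ) ^ 2 = A ^ 2 - 1 / lam ^ 2 := by
  rw [← Complex.ofReal_pow, Real.sq_sqrt (sub_pos.2 (inv_sq_lt_sq hA hl)).le]; push_cast; ring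

theorem eigenRatio_eq (hA : 0 < A) (hl : 1 / A < |lam|) :
    lam * A / (1 - Complex.I * A * root A lam) = eigenRatio A lam := by
  have h : (lam : ℂ) ≠ 0 := Complex.ofReal_ne_zero.2 (ne_zero_of_lt_abs hA hl)
  have hA' : (A : ℂ) ≠ 0 := Complex.ofReal_ne_zero.2 hA.ne'
  have hne : (1 - Complex.I * A * root A lam) ≠ 0 := fun h => by
    have := congrArg Complex.re h
    simp [mul_assoc, ← Complex.ofReal_mul] at this
  have hs := ofReal_sqrt_sq hA hl
  rw [div_eq_iff hne, mul_assoc, ofReal_mul_root_eq hA hl, eigenRatio]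
  generalize ((√(A ^ 2 - 1 / lam ^ 2) : ℝ) : ℂ) = y at hs ⊢
  field_simp at hs ⊢
  linear_combination -hs + lam ^ 2 * y ^ 2 * Complex.I_sq

theorem sqrtCut_sq (z : ℂ) : sqrtCut z ^ 2 = z := by
  have := Complex.cpow_nat_inv_pow (-z) two_ne_zero
  rw [sqrtCut, mul_pow, Complex.I_sq]
  rw [show (1 / 2 : ℂ) = ((2 : ℕ) : ℂ)⁻¹ by norm_num, this]
  ring

/-- This is the statement that `HInv` has determinant one. -/
theorem eigenScale_sq_mul (hA : 0 < A) (hl : 1 / A < |lam|) :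
    eigenScale A lam ^ 2 * (eigenRatio A lam ^ 2 - 1) = 1 := by
  have h : (lam : ℂ) ≠ 0 := Complex.ofReal_ne_zero.2 (ne_zero_of_lt_abs hA hl)
  have hA' : (A : ℂ) ≠ 0 := Complex.ofReal_ne_zero.2 hA.ne'
  have hy : ((√(A ^ 2 - 1 / lam ^ 2) : ℝ) : ℂ) ≠ 0 :=
    Complex.ofReal_ne_zero.2 (sqrt_pos_of_lt_abs hA hl).ne'
  have hs := ofReal_sqrt_sq hA hl
  rw [eigenScale, mul_pow, sqrtCut_sq, ← Complex.ofReal_pow, Real.sq_sqrt (by norm_num),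
    mul_assoc Complex.I, ofReal_mul_root_eq hA hl, eigenRatio]
  generalize ((√(A ^ 2 - 1 / lam ^ 2) : ℝ) : ℂ) = y at hs hy ⊢
  have hI := Complex.I_ne_zero
  have hI2 := Complex.I_sq
  push_cast
  field_simp at hs ⊢
  linear_combination (1 + y * lam * Complex.I) * hs -
    (y ^ 2 * lam ^ 2 + y ^ 3 * lam ^ 3 * Complex.I) * hI2

theorem norm_eigenRatio (hA : 0 < A) (hl : 1 / A < |lam|) : ‖eigenRatio A lam‖ = 1 := by
  have h1 : Complex.normSq (eigenRatio A lam) = 1 := by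
    rw [eigenRatio, Complex.normSq_div, Complex.normSq_ofReal, Complex.normSq_apply]
    have := Real.sq_sqrt (sub_pos.2 (inv_sq_lt_sq hA hl)).le
    rw [div_eq_one_iff_eq (by positivity)]
    have e1 : (1 / (lam : ℂ)) = ((1 / lam : ℝ) : ℂ) := by push_cast; rfl
    rw [e1]
    simp only [Complex.add_re, Complex.add_im, Complex.ofReal_re, Complex.ofReal_im, Complex.mul_re,
      Complex.mul_im, Complex.I_re, Complex.I_im]
    have e2 : (1 / lam) * (1 / lam) = 1 / lam ^ 2 := by field_simp
    linear_combination this + e2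
  rwa [Complex.normSq_eq_norm_sq, pow_eq_one_iff_of_nonneg (norm_nonneg _) two_ne_zero] at h1

theorem eigenRatio_im : (eigenRatio A lam).im = √(A ^ 2 - 1 / lam ^ 2) / A := by
  rw [eigenRatio, Complex.div_ofReal_im]
  have e1 : (1 / (lam : ℂ)) = ((1 / lam : ℝ) : ℂ) := by push_cast; rfl
  rw [e1]
  simp

theorem conj_mul_eq_one {a : ℂ} (h : ‖a‖ = 1) : a * (starRingEnd ℂ) a = 1 := by
  rw [Complex.mul_conj, Complex.normSq_eq_norm_sq, h]; norm_num

theorem norm_sq_sub_one_of_norm_eq_one {a : ℂ} (h : ‖a‖ = 1) : ‖a ^ 2 - 1‖ = 2 * |a.im| := by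
  have h1 : a ^ 2 - 1 = a * (a - (starRingEnd ℂ) a) := by
    linear_combination conj_mul_eq_one h
  rw [h1, norm_mul, h, Complex.sub_conj, one_mul, norm_mul, Complex.norm_I, mul_one,
    Complex.norm_real, Real.norm_eq_abs, abs_mul]
  norm_num

theorem norm_eigenScale_sq_mul (hA : 0 < A) (hl : 1 / A < |lam|) :
    ‖eigenScale A lam‖ ^ 2 * (2 * (eigenRatio A lam).im) = 1 := by
  have h := congrArg norm (eigenScale_sq_mul hA hl)
  have hy := sqrt_pos_of_lt_abs hA hl
  rw [norm_mul, norm_pow, norm_sq_sub_one_of_norm_eq_one (norm_eigenRatio hA hl), norm_one,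
    abs_of_pos (by rw [eigenRatio_im]; positivity)] at h
  exact h

theorem HInv_eq (hA : 0 < A) (hl : 1 / A < |lam|) :
    HInv A lam = eigenScale A lam • !![eigenRatio A lam, 1; 1, eigenRatio A lam] := by
  rw [HInv, eigenRatio_eq hA hl, eigenScale]

end Eigenvectors

section LaxPair

/-- `(v, w)` solves the `x`-equation of the Lax pair. -/
structure LaxSolution (m : ℝ → ℝ) (lam : ℝ) (v w : ℝ → ℂ) : Prop where
  deriv_fst : ∀ x, HasDerivAt v ((-v x + lam * m x * w x) / 2) x
  deriv_snd : ∀ x, HasDerivAt w ((-(lam * m x * v x) + w x) / 2) x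

theorem LaxSolution.wronskian {v w v' w' : ℝ → ℂ} (h : LaxSolution m lam v w)
    (h' : LaxSolution m lam v' w') (x y : ℝ) :
    v x * w' x - w x * v' x = v y * w' y - w y * v' y := by
  have hd : ∀ x, HasDerivAt (fun x => v x * w' x - w x * v' x) 0 x := fun x => by
    refine (((h.deriv_fst x).mul (h'.deriv_snd x)).sub
      ((h.deriv_snd x).mul (h'.deriv_fst x))).congr_deriv ?_
    ring
  exact is_const_of_deriv_eq_zero (fun z => (hd z).differentiableAt) (fun z => (hd z).deriv) x y

theorem LaxSolution.conj {v w : ℝ → ℂ} (h : LaxSolution m lam v w) :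
    LaxSolution m lam (fun x => (starRingEnd ℂ) (v x)) (fun x => (starRingEnd ℂ) (w x)) := by
  refine ⟨fun x => ?_, fun x => ?_⟩
  · refine ((h.deriv_fst x).star).congr_deriv ?_
    simp
  · refine ((h.deriv_snd x).star).congr_deriv ?_
    simp

theorem hasDerivAt_phase (hA : 0 < A) (hm : Continuous m)
    (hmi : ∀ x, IntegrableOn (fun ξ => m ξ - A) (halfLine s x)) (x : ℝ) :
    HasDerivAt (phase s A m lam) (phaseRate A m lam x) x := by
  have h1 := hasDerivAt_integralFrom (s := s) (g := fun ξ => ((m ξ - A : ℝ) : ℂ)) (by fun_prop)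
    (fun x => (hmi x).ofReal) x
  have h2 : HasDerivAt (fun x : ℝ => (x : ℂ) / 2) (1 / 2) x := by
    simpa using (hasDerivAt_id x).ofReal_comp.div_const 2
  refine (((h1.const_mul (1 / (2 * A) : ℂ)).add h2).const_mul
    (Complex.I * A * root A lam)).congr_deriv ?_
  have hA' : (A : ℂ) ≠ 0 := Complex.ofReal_ne_zero.2 hA.ne'
  rw [phaseRate]
  push_cast
  field_simp
  ring

theorem phase_re (x : ℝ) : (phase s A m lam x).re = 0 := by
  have h : ∃ r : ℝ, integralFrom s (fun ξ => ((m ξ - A : ℝ) : ℂ)) x = r := by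
    cases s
    · exact ⟨_, integral_ofReal (𝕜 := ℂ)⟩
    · refine ⟨-∫ ξ in Ioi x, (m ξ - A), ?_⟩
      rw [Complex.ofReal_neg]
      exact congrArg Neg.neg (integral_ofReal (𝕜 := ℂ))
  obtain ⟨r, hr⟩ := h
  rw [phase, hr, show Complex.I * A * root A lam * (1 / (2 * A) * r + x / 2) =
    Complex.I * ((A * root A lam * (1 / (2 * A) * r + x / 2) : ℝ) : ℂ) by push_cast; ring]
  simp

/-- The exponential factor of the `k`-th column of the Jost solution. -/
def phaseExp (s : Side) (A : ℝ) (m : ℝ → ℝ) (lam : ℝ) (k : Fin 2) (x : ℝ) : ℂ :=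
  Complex.exp (-(sgn3 k * phase s A m lam x))

theorem norm_phaseExp (k : Fin 2) (x : ℝ) : ‖phaseExp s A m lam k x‖ = 1 := by
  rw [phaseExp, Complex.norm_exp]
  fin_cases k <;> simp [sgn3, phase_re]

theorem phaseExp_mul (x : ℝ) : phaseExp s A m lam 0 x * phaseExp s A m lam 1 x = 1 := by
  rw [phaseExp, phaseExp, ← Complex.exp_add]; simp [sgn3]

theorem mul_expSigma3_apply (M : Matrix (Fin 2) (Fin 2) ℂ) (x : ℝ) (j k : Fin 2) :
    (M * expSigma3 (-phase s A m lam x)) j k = M j k * phaseExp s A m lam k x := by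
  fin_cases k <;> simp [expSigma3, phaseExp, sgn3, Matrix.mul_apply, Fin.sum_univ_two]

/-- The coordinates of the Jost solutions with respect to the eigenvectors. -/
def jostFrame (s : Side) (A : ℝ) (m : ℝ → ℝ) (lam : ℝ) (j k : Fin 2) (x : ℝ) : ℂ :=
  modifiedJost s A m lam x j k * phaseExp s A m lam k x

theorem jost_zero (hA : 0 < A) (hl : 1 / A < |lam|) (x : ℝ) (k : Fin 2) :
    jost s A m lam x 0 k = eigenScale A lam *
      (eigenRatio A lam * jostFrame s A m lam 0 k x + jostFrame s A m lam 1 k x) := by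
  rw [jost, mul_expSigma3_apply, HInv_eq hA hl, Matrix.smul_mul, Matrix.smul_apply,
    Matrix.mul_apply, Fin.sum_univ_two, smul_eq_mul]
  simp only [jostFrame, Matrix.of_apply, Matrix.cons_val', Matrix.cons_val_zero,
    Matrix.cons_val_one, Matrix.empty_val', Matrix.cons_val_fin_one]
  ring

theorem jost_one (hA : 0 < A) (hl : 1 / A < |lam|) (x : ℝ) (k : Fin 2) :
    jost s A m lam x 1 k = eigenScale A lam *
      (jostFrame s A m lam 0 k x + eigenRatio A lam * jostFrame s A m lam 1 k x) := by
  rw [jost, mul_expSigma3_apply, HInv_eq hA hl, Matrix.smul_mul, Matrix.smul_apply,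
    Matrix.mul_apply, Fin.sum_univ_two, smul_eq_mul]
  simp only [jostFrame, Matrix.of_apply, Matrix.cons_val', Matrix.cons_val_zero,
    Matrix.cons_val_one, Matrix.empty_val', Matrix.cons_val_fin_one]
  ring

theorem hasDerivAt_jostFrame (hA : 0 < A) (hm : Continuous m)
    (hmi : ∀ x, IntegrableOn (fun ξ => m ξ - A) (halfLine s x)) (j k : Fin 2) (x : ℝ) :
    HasDerivAt (jostFrame s A m lam j k)
      (W A m lam x j 0 * jostFrame s A m lam 0 k x + W A m lam x j 1 * jostFrame s A m lam 1 k x -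
        sgn3 j * phaseRate A m lam x * jostFrame s A m lam j k x) x := by
  have h1 : HasDerivAt (phaseExp s A m lam k)
      (-(sgn3 k * phaseRate A m lam x) * phaseExp s A m lam k x) x := by
    refine (((hasDerivAt_phase (lam := lam) hA hm hmi x).const_mul (sgn3 k)).neg.cexp).congr_deriv ?_
    simp only [phaseExp, Pi.neg_apply]; ring
  refine (((isModifiedJostODE_modifiedJost hm hmi).deriv x j k).mul h1).congr_deriv ?_
  simp only [jostFrame, Matrix.mul_apply, Fin.sum_univ_two]
  ring

theorem laxSolution_jost (hA : 0 < A) (hl : 1 / A < |lam|) (hm : Continuous m)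
    (hmi : ∀ x, IntegrableOn (fun ξ => m ξ - A) (halfLine s x)) (k : Fin 2) :
    LaxSolution m lam (fun x => jost s A m lam x 0 k) (fun x => jost s A m lam x 1 k) := by
  have hl0 : (lam : ℂ) ≠ 0 := Complex.ofReal_ne_zero.2 (ne_zero_of_lt_abs hA hl)
  have hA' : (A : ℂ) ≠ 0 := Complex.ofReal_ne_zero.2 hA.ne'
  have hy : ((√(A ^ 2 - 1 / lam ^ 2) : ℝ) : ℂ) ≠ 0 :=
    Complex.ofReal_ne_zero.2 (sqrt_pos_of_lt_abs hA hl).ne'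
  have hs := ofReal_sqrt_sq hA hl
  have hr : (root A lam : ℂ) = lam * √(A ^ 2 - 1 / lam ^ 2) / A := by
    rw [eq_div_iff hA', ← ofReal_mul_root_eq hA hl, mul_comm]
  have hI2 := Complex.I_sq
  have hI := Complex.I_ne_zero
  have e0 : ∀ x, W A m lam x 1 1 = -W A m lam x 0 0 := fun x => by
    linear_combination W_trace (A := A) (m := m) (lam := lam) x
  have e0' : ∀ x, W A m lam x 0 1 = -W A m lam x 1 0 := fun x => by
    simp [W, sigma2, sigma3]
  -- Together with the symmetries `e0` and `e0'`, the identities `e1` and `e2` are the four entries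
  -- of H⁻¹(Ŵ - `phaseRate`·σ₃) = U H⁻¹, with U the coefficient matrix of the Lax equation.
  have e1 : ∀ x, eigenRatio A lam * (W A m lam x 0 0 - phaseRate A m lam x) + W A m lam x 1 0 =
      (-eigenRatio A lam + lam * m x) / 2 := fun x => by
    simp only [W, sigma2, sigma3, phaseRate, eigenRatio, Matrix.add_apply, Matrix.smul_apply,
      Matrix.of_apply, Matrix.cons_val', Matrix.cons_val_zero, Matrix.cons_val_one,
      Matrix.cons_val_fin_one, smul_eq_mul, hr]
    generalize ((√(A ^ 2 - 1 / lam ^ 2) : ℝ) : ℂ) = y at hs hy ⊢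
    field_simp at hs ⊢
    linear_combination (y * lam * Complex.I * m x - (m x - A) * Complex.I ^ 2) * hs +
      (m x - A - y ^ 3 * lam ^ 3 * Complex.I * m x) * hI2
  have e2 : ∀ x, eigenRatio A lam * W A m lam x 1 0 + (W A m lam x 0 0 - phaseRate A m lam x) =
      (1 - lam * m x * eigenRatio A lam) / 2 := fun x => by
    simp only [W, sigma2, sigma3, phaseRate, eigenRatio, Matrix.add_apply, Matrix.smul_apply,
      Matrix.of_apply, Matrix.cons_val', Matrix.cons_val_zero, Matrix.cons_val_one,
      Matrix.cons_val_fin_one, smul_eq_mul, hr]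
    generalize ((√(A ^ 2 - 1 / lam ^ 2) : ℝ) : ℂ) = y at hs hy ⊢
    field_simp at hs ⊢
    linear_combination A * lam * (m x - A) * (1 + y * lam * Complex.I) * hI2
  have d0 := fun x => hasDerivAt_jostFrame (lam := lam) hA hm hmi 0 k x
  have d1 := fun x => hasDerivAt_jostFrame (lam := lam) hA hm hmi 1 k x
  have s0 : sgn3 0 = 1 := rfl
  have s1 : sgn3 1 = -1 := rfl
  refine ⟨fun x => ?_, fun x => ?_⟩
  · simp only [jost_zero hA hl, jost_one hA hl]
    refine ((((d0 x).const_mul (eigenRatio A lam)).add (d1 x)).const_mul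
      (eigenScale A lam)).congr_deriv ?_
    rw [e0, e0', s0, s1]
    linear_combination eigenScale A lam * jostFrame s A m lam 0 k x * e1 x -
      eigenScale A lam * jostFrame s A m lam 1 k x * e2 x
  · simp only [jost_zero hA hl, jost_one hA hl]
    refine (((d0 x).add ((d1 x).const_mul (eigenRatio A lam))).const_mul
      (eigenScale A lam)).congr_deriv ?_
    rw [e0, e0', s0, s1]
    linear_combination eigenScale A lam * jostFrame s A m lam 0 k x * e2 x -
      eigenScale A lam * jostFrame s A m lam 1 k x * e1 x

end LaxPair

end

end MCH

/-! ### The scattering matrix and the relation |c₁₁|² = 1 + |c₂₁|². -/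

namespace MCH

open Set Filter Topology

noncomputable section

variable {A A₁ A₂ lam : ℝ} {m : ℝ → ℝ} {s : Side}

theorem jost_det (hA : 0 < A) (hl : 1 / A < |lam|) (hm : Continuous m)
    (hmi : ∀ x, IntegrableOn (fun ξ => m ξ - A) (halfLine s x)) (x : ℝ) :
    jost s A m lam x 0 0 * jost s A m lam x 1 1 - jost s A m lam x 1 0 * jost s A m lam x 0 1 =
      1 := by
  have h1 := eigenScale_sq_mul hA hl
  have h2 := (isModifiedJostODE_modifiedJost (lam := lam) hm hmi).det_eq_one hm x
  have h3 := phaseExp_mul (s := s) (A := A) (m := m) (lam := lam) x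
  simp only [jost_zero hA hl, jost_one hA hl, jostFrame]
  linear_combination h1 + h2 * (eigenScale A lam ^ 2 * (eigenRatio A lam ^ 2 - 1)) +
    eigenScale A lam ^ 2 * (eigenRatio A lam ^ 2 - 1) * (modifiedJost s A m lam x 0 0 *
      modifiedJost s A m lam x 1 1 - modifiedJost s A m lam x 1 0 *
        modifiedJost s A m lam x 0 1) * h3

/-- Cramer's rule: the right Jost solution has determinant one, so up to sign the entries of c are
Wronskians of Lax solutions, which do not depend on x. -/
theorem existsUnique_scatteringMatrix (hA₁ : 0 < A₁) (hA₂ : 0 < A₂) (hl₁ : 1 / A₁ < |lam|)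
    (hl₂ : 1 / A₂ < |lam|) (hm : Continuous m)
    (hmi₁ : ∀ x, IntegrableOn (fun ξ => m ξ - A₁) (halfLine .left x))
    (hmi₂ : ∀ x, IntegrableOn (fun ξ => m ξ - A₂) (halfLine .right x)) :
    ∃! c, IsScatteringMatrix A₁ A₂ m lam c := by
  have hd := jost_det hA₂ hl₂ hm hmi₂
  set J := jost .left A₁ m lam with hJ
  set K := jost .right A₂ m lam with hK
  have hw : ∀ j k x, K x 0 j * J x 1 k - K x 1 j * J x 0 k =
      K 0 0 j * J 0 1 k - K 0 1 j * J 0 0 k := fun j k x =>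
    (laxSolution_jost hA₂ hl₂ hm hmi₂ j).wronskian (laxSolution_jost hA₁ hl₁ hm hmi₁ k) x 0
  set w : Fin 2 → Fin 2 → ℂ := fun j k => K 0 0 j * J 0 1 k - K 0 1 j * J 0 0 k
  refine ⟨!![-w 1 0, -w 1 1; w 0 0, w 0 1], fun x => ?_, fun c hc => ?_⟩
  · ext i k
    have h0 := hw 0 k x
    have h1 := hw 1 k x
    have hdx := hd x
    rw [Matrix.mul_apply, Fin.sum_univ_two]
    fin_cases i <;> fin_cases k <;> simp [w] at h0 h1 ⊢
    · linear_combination -J x 0 0 * hdx + K x 0 1 * h0 - K x 0 0 * h1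
    · linear_combination -J x 0 1 * hdx + K x 0 1 * h0 - K x 0 0 * h1
    · linear_combination -J x 1 0 * hdx + K x 1 1 * h0 - K x 1 0 * h1
    · linear_combination -J x 1 1 * hdx + K x 1 1 * h0 - K x 1 0 * h1
  · have hc0 : ∀ i k, J 0 i k = K 0 i 0 * c 0 k + K 0 i 1 * c 1 k := fun i k => by
      have := congrFun (congrFun (hc 0) i) k
      rwa [Matrix.mul_apply, Fin.sum_univ_two] at this
    have hd0 := hd 0
    ext i k
    fin_cases i <;> fin_cases k <;> simp [w, hc0]
    · linear_combination -c 0 0 * hd0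
    · linear_combination -c 0 1 * hd0
    · linear_combination -c 1 0 * hd0
    · linear_combination -c 1 1 * hd0

/-- Only the modulus converges, because each column keeps its oscillating unimodular factor. -/
theorem tendsto_norm_jostFrame (hm : Continuous m)
    (hmi : ∀ x, IntegrableOn (fun ξ => m ξ - A) (halfLine s x)) (c : Fin 2 → ℂ) (j : Fin 2) :
    Tendsto (fun x => ‖jostFrame s A m lam j 0 x * c 0 + jostFrame s A m lam j 1 x * c 1‖)
      s.filter (𝓝 ‖c j‖) := by
  have hΦ := isModifiedJostODE_modifiedJost (lam := lam) hm hmi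
  have h1 : ∀ k, Tendsto (fun x => (modifiedJost s A m lam x j k -
      (1 : Matrix (Fin 2) (Fin 2) ℂ) j k) * (phaseExp s A m lam k x * c k)) s.filter (𝓝 0) :=
    fun k => by
      have h2 := ((hΦ.tendsto j k).sub_const ((1 : Matrix (Fin 2) (Fin 2) ℂ) j k)).norm.mul_const
        ‖c k‖
      rw [sub_self, norm_zero, zero_mul] at h2
      rw [tendsto_zero_iff_norm_tendsto_zero]
      simpa only [norm_mul, norm_phaseExp, one_mul] using h2
  have h3 := (((h1 0).add (h1 1)).norm)
  rw [add_zero, norm_zero] at h3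
  rw [tendsto_iff_norm_sub_tendsto_zero]
  refine squeeze_zero (fun _ => norm_nonneg _) (fun x => ?_) h3
  have h4 : ‖c j‖ = ‖phaseExp s A m lam j x * c j‖ := by rw [norm_mul, norm_phaseExp, one_mul]
  rw [h4]
  refine (abs_norm_sub_norm_le _ _).trans (le_of_eq (congrArg norm ?_))
  simp only [jostFrame]
  obtain rfl | rfl : j = 0 ∨ j = 1 := by fin_cases j <;> simp
  all_goals simp only [Matrix.one_apply, if_true, one_ne_zero, zero_ne_one, if_false]; ring

variable {v w : ℝ → ℂ}

/-- The right-hand side does not involve A. The conserved quantity Im(v w̄) can therefore be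
evaluated in the A₁-eigenbasis at -∞ and in the A₂-eigenbasis at +∞. -/
theorem norm_sq_sub_norm_sq_eq (hA : 0 < A) (hl : 1 / A < |lam|) (p q : ℂ) :
    ‖eigenScale A lam * (eigenRatio A lam * p - q)‖ ^ 2 -
      ‖eigenScale A lam * (eigenRatio A lam * q - p)‖ ^ 2 = 2 * (p * (starRingEnd ℂ) q).im := by
  have h1 := norm_eigenScale_sq_mul hA hl
  have h2 := norm_eigenRatio hA hl
  have h3 : Complex.normSq (eigenRatio A lam) = 1 := by rw [Complex.normSq_eq_norm_sq, h2, one_pow]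
  rw [norm_mul, norm_mul, mul_pow, mul_pow, ← mul_sub,
    ← Complex.normSq_eq_norm_sq (_ * p - q), ← Complex.normSq_eq_norm_sq (_ * q - p)]
  simp only [Complex.normSq_apply, Complex.sub_re, Complex.sub_im, Complex.mul_re, Complex.mul_im,
    Complex.conj_re, Complex.conj_im] at h3 ⊢
  linear_combination ‖eigenScale A lam‖ ^ 2 * (p.re ^ 2 + p.im ^ 2 - q.re ^ 2 - q.im ^ 2) * h3 +
    2 * (p.im * q.re - p.re * q.im) * h1

theorem LaxSolution.im_const (h : LaxSolution m lam v w) (x y : ℝ) :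
    (v x * (starRingEnd ℂ) (w x)).im = (v y * (starRingEnd ℂ) (w y)).im := by
  have := congrArg Complex.im (h.wronskian h.conj x y)
  simp only [Complex.sub_im, Complex.mul_im, Complex.conj_re, Complex.conj_im] at this ⊢
  linarith

/-- The first column of the left Jost solution in the two eigenvector frames. -/
theorem exists_laxSolution_tendsto (hA₁ : 0 < A₁) (hA₂ : 0 < A₂) (hl₁ : 1 / A₁ < |lam|)
    (hl₂ : 1 / A₂ < |lam|) (hm : Continuous m)
    (hmi₁ : ∀ x, IntegrableOn (fun ξ => m ξ - A₁) (halfLine .left x))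
    (hmi₂ : ∀ x, IntegrableOn (fun ξ => m ξ - A₂) (halfLine .right x)) :
    ∃ v w, LaxSolution m lam v w ∧
      Tendsto (fun x => ‖eigenScale A₁ lam * (eigenRatio A₁ lam * v x - w x)‖) atBot (𝓝 1) ∧
      Tendsto (fun x => ‖eigenScale A₁ lam * (eigenRatio A₁ lam * w x - v x)‖) atBot (𝓝 0) ∧
      Tendsto (fun x => ‖eigenScale A₂ lam * (eigenRatio A₂ lam * v x - w x)‖) atTop
        (𝓝 ‖scatteringMatrix A₁ A₂ m lam 0 0‖) ∧
      Tendsto (fun x => ‖eigenScale A₂ lam * (eigenRatio A₂ lam * w x - v x)‖) atTop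
        (𝓝 ‖scatteringMatrix A₁ A₂ m lam 1 0‖) := by
  set c := scatteringMatrix A₁ A₂ m lam with hc
  have hcs : IsScatteringMatrix A₁ A₂ m lam c := Classical.epsilon_spec
    (existsUnique_scatteringMatrix hA₁ hA₂ hl₁ hl₂ hm hmi₁ hmi₂).exists
  have hJ : ∀ x i, jost .left A₁ m lam x i 0 = jost .right A₂ m lam x i 0 * c 0 0 +
      jost .right A₂ m lam x i 1 * c 1 0 := fun x i => by
    rw [hcs x, Matrix.mul_apply, Fin.sum_univ_two]
  have h1 := eigenScale_sq_mul hA₁ hl₁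
  have h2 := eigenScale_sq_mul hA₂ hl₂
  -- By κ²(a² - 1) = 1, the combinations κ(av - w) and κ(aw - v) invert `HInv` and recover the
  -- coordinates `jostFrame`.
  refine ⟨_, _, laxSolution_jost hA₁ hl₁ hm hmi₁ 0, ?_, ?_, ?_, ?_⟩
  · refine Tendsto.congr (fun x => congrArg norm ?_) ((tendsto_norm_jostFrame (s := .left)
      (lam := lam) hm hmi₁ ![1, 0] 0).trans (by simp))
    simp only [jost_zero hA₁ hl₁, jost_one hA₁ hl₁, Matrix.cons_val_zero, Matrix.cons_val_one]
    linear_combination -jostFrame .left A₁ m lam 0 0 x * h1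
  · refine Tendsto.congr (fun x => congrArg norm ?_) ((tendsto_norm_jostFrame (s := .left)
      (lam := lam) hm hmi₁ ![1, 0] 1).trans (by simp))
    simp only [jost_zero hA₁ hl₁, jost_one hA₁ hl₁, Matrix.cons_val_zero, Matrix.cons_val_one]
    linear_combination -jostFrame .left A₁ m lam 1 0 x * h1
  · refine Tendsto.congr (fun x => congrArg norm ?_) (tendsto_norm_jostFrame (s := .right)
      (lam := lam) hm hmi₂ (fun k => c k 0) 0)
    simp only [hJ, jost_zero hA₂ hl₂, jost_one hA₂ hl₂]
    linear_combination -(jostFrame .right A₂ m lam 0 0 x * c 0 0 +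
      jostFrame .right A₂ m lam 0 1 x * c 1 0) * h2
  · refine Tendsto.congr (fun x => congrArg norm ?_) (tendsto_norm_jostFrame (s := .right)
      (lam := lam) hm hmi₂ (fun k => c k 0) 1)
    simp only [hJ, jost_zero hA₂ hl₂, jost_one hA₂ hl₂]
    linear_combination -(jostFrame .right A₂ m lam 1 0 x * c 0 0 +
      jostFrame .right A₂ m lam 1 1 x * c 1 0) * h2

/-- The coordinates of the first left Jost column have moduli (1, 0) in the limit at -∞ and (|c₁₁|,
|c₂₁|) at +∞; the difference of their squares is conserved. -/
theorem norm_scatteringMatrix_sq (hA₁ : 0 < A₁) (hA₂ : 0 < A₂) (hl₁ : 1 / A₁ < |lam|)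
    (hl₂ : 1 / A₂ < |lam|) (hm : Continuous m)
    (hmi₁ : ∀ x, IntegrableOn (fun ξ => m ξ - A₁) (halfLine .left x))
    (hmi₂ : ∀ x, IntegrableOn (fun ξ => m ξ - A₂) (halfLine .right x)) :
    ‖scatteringMatrix A₁ A₂ m lam 0 0‖ ^ 2 =
      1 + ‖scatteringMatrix A₁ A₂ m lam 1 0‖ ^ 2 := by
  obtain ⟨v, w, h, h1, h2, h3, h4⟩ :=
    exists_laxSolution_tendsto hA₁ hA₂ hl₁ hl₂ hm hmi₁ hmi₂
  have hleft := (h1.pow 2).sub (h2.pow 2)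
  have hright := (h3.pow 2).sub (h4.pow 2)
  simp only [norm_sq_sub_norm_sq_eq hA₁ hl₁, h.im_const _ 0] at hleft
  simp only [norm_sq_sub_norm_sq_eq hA₂ hl₂, h.im_const _ 0] at hright
  have e1 := tendsto_nhds_unique hleft tendsto_const_nhds
  have e2 := tendsto_nhds_unique hright tendsto_const_nhds
  linarith

theorem reflectionDefinedAt (hA₁ : 0 < A₁) (hA₂ : 0 < A₂) (hl₁ : 1 / A₁ < |lam|)
    (hl₂ : 1 / A₂ < |lam|) (hm : Continuous m)
    (hmi₁ : ∀ x, IntegrableOn (fun ξ => m ξ - A₁) (halfLine .left x))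
    (hmi₂ : ∀ x, IntegrableOn (fun ξ => m ξ - A₂) (halfLine .right x)) :
    ReflectionDefinedAt A₁ A₂ m lam where
  left := existsUnique_isModifiedJost hm hmi₁
  right := existsUnique_isModifiedJost hm hmi₂
  scattering := existsUnique_scatteringMatrix hA₁ hA₂ hl₁ hl₂ hm hmi₁ hmi₂
  ne_zero h := by
    have := norm_scatteringMatrix_sq hA₁ hA₂ hl₁ hl₂ hm hmi₁ hmi₂
    rw [h, norm_zero] at this
    nlinarith [sq_nonneg ‖scatteringMatrix A₁ A₂ m lam 1 0‖]

/-- Since |c₁₁| ≥ 1, decay of r follows from decay of c₂₁ alone. -/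
theorem norm_reflectionCoefficient_le (hA₁ : 0 < A₁) (hA₂ : 0 < A₂) (hl₁ : 1 / A₁ < |lam|)
    (hl₂ : 1 / A₂ < |lam|) (hm : Continuous m)
    (hmi₁ : ∀ x, IntegrableOn (fun ξ => m ξ - A₁) (halfLine .left x))
    (hmi₂ : ∀ x, IntegrableOn (fun ξ => m ξ - A₂) (halfLine .right x)) :
    ‖reflectionCoefficient A₁ A₂ m lam‖ ≤ ‖scatteringMatrix A₁ A₂ m lam 1 0‖ := by
  have h := norm_scatteringMatrix_sq hA₁ hA₂ hl₁ hl₂ hm hmi₁ hmi₂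
  rw [reflectionCoefficient, norm_div]
  refine div_le_self (norm_nonneg _) ((one_le_sq_iff₀ (norm_nonneg _)).1 ?_)
  rw [h]
  exact le_add_of_nonneg_right (sq_nonneg _)

end

end MCH

/-! ### Limits, lower bound and regularity of the momentum. -/

namespace MCH

open Set Filter Topology

section Bounds

theorem exists_norm_le_of_tendsto_atBot_atTop {E : Type*} [SeminormedAddCommGroup E] {f : ℝ → E}
    (hf : Continuous f) {e e' : E} (he : Tendsto f atBot (𝓝 e)) (he' : Tendsto f atTop (𝓝 e')) :
    ∃ C, ∀ x, ‖f x‖ ≤ C := by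
  obtain ⟨C, hC⟩ := exists_norm_le_of_tendsto (s := .left) hf he 0
  obtain ⟨C', hC'⟩ := exists_norm_le_of_tendsto (s := .right) hf he' 0
  refine ⟨max C C', fun x => ?_⟩
  rcases le_or_gt x 0 with h | h
  · exact (hC x h).trans (le_max_left _ _)
  · exact (hC' x h).trans (le_max_right _ _)

theorem tendsto_zero_atBot_of_integrable {f f' : ℝ → ℝ} (hd : ∀ x, HasDerivAt f (f' x) x)
    (hf : Integrable f) (hf' : Integrable f') : Tendsto f atBot (𝓝 0) :=
  tendsto_zero_of_hasDerivAt_of_integrableOn_Iic (a := 0) (fun x _ => hd x) hf'.integrableOn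
    hf.integrableOn

theorem tendsto_zero_atTop_of_integrable {f f' : ℝ → ℝ} (hd : ∀ x, HasDerivAt f (f' x) x)
    (hf : Integrable f) (hf' : Integrable f') : Tendsto f atTop (𝓝 0) :=
  tendsto_zero_of_hasDerivAt_of_integrableOn_Ioi (a := 0) (fun x _ => hd x) hf'.integrableOn
    hf.integrableOn

end Bounds

/-- A positive profile with integrable derivative `m₁`, bounded below by `δ`, with limits `A₁`
and `A₂` at the two infinities. -/
structure Profile (A₁ A₂ δ : ℝ) (m m₁ : ℝ → ℝ) : Prop where
  hasDerivAt : ∀ x, HasDerivAt m (m₁ x) x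
  continuous_deriv : Continuous m₁
  integrable_deriv : Integrable m₁
  pos : 0 < δ
  le : ∀ x, δ ≤ m x
  tendsto_atBot : Tendsto m atBot (𝓝 A₁)
  tendsto_atTop : Tendsto m atTop (𝓝 A₂)

namespace StepLikeData

variable {A₁ A₂ : ℝ} {N : ℕ} {u : ℝ → ℝ}

theorem contDiff_momentum (h : StepLikeData A₁ A₂ N u) : ContDiff ℝ N (momentum u) := by
  have h1 : ContDiff ℝ ((N : ℕ∞) + (2 : ℕ) : WithTop ℕ∞) u := by exact_mod_cast h.contDiff
  have h2 : ContDiff ℝ N (iteratedDeriv 2 u) := by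
    rw [iteratedDeriv_eq_iterate]; exact ContDiff.iterate_deriv' N 2 h1
  exact (h.contDiff.of_le (by exact_mod_cast Nat.le_add_right N 2)).sub h2

theorem continuous (h : StepLikeData A₁ A₂ N u) : Continuous (momentum u) :=
  h.contDiff_momentum.continuous

theorem continuous_iteratedDeriv (h : StepLikeData A₁ A₂ N u) {l : ℕ} (hl : l ≤ N) :
    Continuous (iteratedDeriv l (momentum u)) :=
  h.contDiff_momentum.continuous_iteratedDeriv l (by exact_mod_cast hl)

theorem hasDerivAt_iteratedDeriv (h : StepLikeData A₁ A₂ N u) {l : ℕ} (hl : l < N) (x : ℝ) :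
    HasDerivAt (iteratedDeriv l (momentum u)) (iteratedDeriv (l + 1) (momentum u) x) x := by
  rw [iteratedDeriv_succ]
  exact (h.contDiff_momentum.differentiable_iteratedDeriv l (by exact_mod_cast hl) x).hasDerivAt

theorem integrable_iteratedDeriv (h : StepLikeData A₁ A₂ N u) {l : ℕ} (hl0 : 1 ≤ l) (hl : l ≤ N) :
    Integrable (iteratedDeriv l (momentum u)) := by
  simpa using h.moment_deriv 0 (Nat.zero_le _) l hl0 hl

theorem integrableOn_left (h : StepLikeData A₁ A₂ N u) (x : ℝ) :
    IntegrableOn (fun ξ => momentum u ξ - A₁) (halfLine .left x) := by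
  have h0 : IntegrableOn (fun ξ => momentum u ξ - A₁) (Iio 0) := by
    simpa using h.moment_left 0 (Nat.zero_le _)
  refine (h0.union ((h.continuous.sub continuous_const).integrableOn_Icc (a := 0)
    (b := x))).mono_set fun ξ hξ => ?_
  rcases lt_or_ge ξ 0 with h | h
  · exact Or.inl h
  · exact Or.inr ⟨h, hξ⟩

theorem integrableOn_right (h : StepLikeData A₁ A₂ N u) (x : ℝ) :
    IntegrableOn (fun ξ => momentum u ξ - A₂) (halfLine .right x) := by
  have h0 : IntegrableOn (fun ξ => momentum u ξ - A₂) (Ioi 0) := by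
    simpa using h.moment_right 0 (Nat.zero_le _)
  refine (h0.union ((h.continuous.sub continuous_const).integrableOn_Icc (a := x)
    (b := 0))).mono_set fun ξ hξ => ?_
  rcases lt_or_ge 0 ξ with h | h
  · exact Or.inl h
  · exact Or.inr ⟨le_of_lt hξ, h⟩

theorem exists_profile (h : StepLikeData A₁ A₂ N u) (hN : 1 ≤ N) (hA₁ : 0 < A₁) (hA₂ : 0 < A₂) :
    ∃ δ, Profile A₁ A₂ δ (momentum u) (iteratedDeriv 1 (momentum u)) := by
  have hd : ∀ x, HasDerivAt (momentum u) (iteratedDeriv 1 (momentum u) x) x := fun x => by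
    simpa using h.hasDerivAt_iteratedDeriv (l := 0) hN x
  have hi := h.integrable_iteratedDeriv le_rfl hN
  have hbot : Tendsto (momentum u) atBot (𝓝 A₁) := by
    have := (tendsto_zero_of_hasDerivAt_of_integrableOn_Iic (a := 0)
      (fun x _ => (hd x).sub_const A₁) hi.integrableOn (h.integrableOn_left 0)).add_const A₁
    simpa using this
  have htop : Tendsto (momentum u) atTop (𝓝 A₂) := by
    have := (tendsto_zero_of_hasDerivAt_of_integrableOn_Ioi (a := 0)
      (fun x _ => (hd x).sub_const A₂) hi.integrableOn (h.integrableOn_right 0)).add_const A₂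
    simpa using this
  have hpos := h.momentum_pos
  -- A positive lower bound for m is an upper bound for 1/m, which is continuous with finite limits
  -- at both ends.
  obtain ⟨C, hC⟩ := exists_norm_le_of_tendsto_atBot_atTop
    (h.continuous.inv₀ fun x => (hpos x).ne') (hbot.inv₀ hA₁.ne') (htop.inv₀ hA₂.ne')
  have hC0 : 0 < C := (norm_pos_iff.2 (inv_ne_zero (hpos 0).ne')).trans_le (hC 0)
  refine ⟨C⁻¹, hd, h.continuous_iteratedDeriv hN, hi, inv_pos.2 hC0, fun x => ?_, hbot, htop⟩
  have := hC x
  rw [Pi.inv_apply, Real.norm_of_nonneg (inv_pos.2 (hpos x)).le] at this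
  exact inv_le_of_inv_le₀ (hpos x) this

end StepLikeData

end MCH

/-! ### Gronwall estimates and the frame of local eigenvectors. -/

namespace MCH

open Set Filter Topology

noncomputable section

section Gronwall

/-- Gronwall's inequality started at -∞: N·exp(-K) is antitone and so stays below its limit there.
-/
theorem le_mul_exp_integral {N N' k : ℝ → ℝ} {L : ℝ} (hN : ∀ x, HasDerivAt N (N' x) x)
    (hk : Continuous k) (hki : Integrable k) (hk0 : ∀ x, 0 ≤ k x) (hle : ∀ x, N' x ≤ k x * N x)
    (hL : Tendsto N atBot (𝓝 L)) (hL0 : 0 ≤ L) (x : ℝ) : N x ≤ L * Real.exp (∫ ξ, k ξ) := by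
  set K : ℝ → ℝ := fun x => ∫ ξ in Iic x, k ξ with hK
  have hKd : ∀ x, HasDerivAt K (k x) x :=
    hasDerivAt_setIntegral_Iic hk fun x => hki.integrableOn
  have hd : ∀ x, HasDerivAt (fun x => N x * Real.exp (-K x))
      ((N' x - k x * N x) * Real.exp (-K x)) x := fun x => by
    refine ((hN x).mul (hKd x).neg.exp).congr_deriv ?_
    simp only [Pi.neg_apply]; ring
  have hanti : Antitone fun x => N x * Real.exp (-K x) :=
    antitone_of_deriv_nonpos (fun x => (hd x).differentiableAt) fun x => by
      rw [(hd x).deriv]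
      exact mul_nonpos_of_nonpos_of_nonneg (sub_nonpos.2 (hle x)) (Real.exp_pos _).le
  have hlim : Tendsto (fun x => N x * Real.exp (-K x)) atBot (𝓝 L) := by
    have hK0 : Tendsto K atBot (𝓝 0) := tendsto_integral_Iic_zero (f := k) tendsto_id
    have := hL.mul ((Real.continuous_exp.tendsto _).comp hK0.neg)
    simpa using this
  have h1 : N x * Real.exp (-K x) ≤ L :=
    ge_of_tendsto hlim ((eventually_le_atBot x).mono fun y hy => hanti hy)
  have h2 : K x ≤ ∫ ξ, k ξ := setIntegral_le_integral hki (ae_of_all _ hk0)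
  calc N x = N x * Real.exp (-K x) * Real.exp (K x) := by
        rw [mul_assoc, ← Real.exp_add]; simp
    _ ≤ L * Real.exp (K x) := mul_le_mul_of_nonneg_right h1 (Real.exp_pos _).le
    _ ≤ _ := mul_le_mul_of_nonneg_left (Real.exp_le_exp.2 h2) hL0

/-- Only Re q has to be integrable: Im q, which will be the large phase, does not change moduli. The
integrating factor therefore starts at 0 and not at -∞, and the factor 2 in the exponent comes from
bounding both exp(-Q) and exp(Q). -/
theorem norm_le_exp_integral_mul {T q e : ℝ → ℂ} {k h : ℝ → ℝ}
    (hT : ∀ x, HasDerivAt T (q x * T x + e x) x) (hq : Continuous q) (he : Continuous e)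
    (hki : Integrable k) (hqk : ∀ x, |(q x).re| ≤ k x)
    (hh : Integrable h) (heh : ∀ x, ‖e x‖ ≤ h x) (hT0 : Tendsto T atBot (𝓝 0)) (x : ℝ) :
    ‖T x‖ ≤ Real.exp (2 * ∫ ξ, k ξ) * ∫ ξ, h ξ := by
  set κ := ∫ ξ, k ξ with hκ
  set Q : ℝ → ℂ := fun x => ∫ ξ in (0 : ℝ)..x, q ξ with hQ
  have hk0 : ∀ x, 0 ≤ k x := fun x => (abs_nonneg _).trans (hqk x)
  have hh0 : ∀ x, 0 ≤ h x := fun x => (norm_nonneg _).trans (heh x)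
  have hQd : ∀ x, HasDerivAt Q (q x) x := fun x =>
    intervalIntegral.integral_hasDerivAt_right (hq.intervalIntegrable _ _)
      (hq.stronglyMeasurableAtFilter _ _) hq.continuousAt
  have hQc : Continuous Q := continuous_iff_continuousAt.2 fun x => (hQd x).continuousAt
  have hbound : ∀ (g : ℝ → ℝ), Integrable g → (∀ x, 0 ≤ g x) → ∀ a b,
      ∫ ξ in uIoc a b, g ξ ≤ ∫ ξ, g ξ := fun g hg hg0 a b =>
    setIntegral_le_integral hg (ae_of_all _ hg0)
  have hQre : ∀ x, |(Q x).re| ≤ κ := fun x => by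
    have h1 : (Q x).re = ∫ ξ in (0 : ℝ)..x, (q ξ).re :=
      (Complex.reCLM.intervalIntegral_comp_comm (hq.intervalIntegrable 0 x)).symm
    rw [h1, ← Real.norm_eq_abs]
    refine intervalIntegral.norm_integral_le_integral_norm_uIoc.trans
      (le_trans ?_ (hbound k hki hk0 0 x))
    refine integral_mono_of_nonneg (ae_of_all _ fun _ => norm_nonneg _) hki.integrableOn
      (ae_of_all _ hqk)
  have hexp : ∀ x, ‖Complex.exp (-Q x)‖ ≤ Real.exp κ := fun x => by
    rw [Complex.norm_exp, Complex.neg_re]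
    exact Real.exp_le_exp.2 ((neg_le_abs _).trans (hQre x))
  have hd : ∀ x, HasDerivAt (fun x => Complex.exp (-Q x) * T x) (Complex.exp (-Q x) * e x) x :=
    fun x => by
      refine ((hQd x).neg.cexp.mul (hT x)).congr_deriv ?_
      simp only [Pi.neg_apply]; ring
  have hcont : Continuous fun x => Complex.exp (-Q x) * e x := by fun_prop
  have hdiff : ∀ y, ‖Complex.exp (-Q x) * T x - Complex.exp (-Q y) * T y‖ ≤
      Real.exp κ * ∫ ξ, h ξ := fun y => by
    rw [← intervalIntegral.integral_eq_sub_of_hasDerivAt (fun z _ => hd z)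
      (hcont.intervalIntegrable y x)]
    refine intervalIntegral.norm_integral_le_integral_norm_uIoc.trans ?_
    rw [← integral_const_mul]
    refine le_trans (integral_mono_of_nonneg (ae_of_all _ fun _ => norm_nonneg _)
      (hh.const_mul (Real.exp κ)).integrableOn (ae_of_all _ fun z => ?_))
      (hbound _ (hh.const_mul (Real.exp κ)) (fun x => mul_nonneg (Real.exp_pos _).le (hh0 x)) y x)
    change ‖Complex.exp (-Q z) * e z‖ ≤ Real.exp κ * h z
    rw [norm_mul]
    exact mul_le_mul (hexp z) (heh z) (norm_nonneg _) (Real.exp_pos _).le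
  have hlim : Tendsto (fun y => Complex.exp (-Q y) * T y) atBot (𝓝 0) := by
    rw [tendsto_zero_iff_norm_tendsto_zero]
    have := hT0.norm.const_mul (Real.exp κ)
    rw [norm_zero, mul_zero] at this
    refine squeeze_zero (fun _ => norm_nonneg _) (fun y => ?_) this
    rw [norm_mul]
    exact mul_le_mul_of_nonneg_right (hexp y) (norm_nonneg _)
  have h2 : ‖Complex.exp (-Q x) * T x‖ ≤ Real.exp κ * ∫ ξ, h ξ := by
    have := (hlim.const_sub (Complex.exp (-Q x) * T x)).norm
    rw [sub_zero] at this
    exact le_of_tendsto' this hdiff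
  calc ‖T x‖ = ‖Complex.exp (Q x)‖ * ‖Complex.exp (-Q x) * T x‖ := by
        rw [← norm_mul, ← mul_assoc, ← Complex.exp_add]; simp
    _ ≤ Real.exp κ * (Real.exp κ * ∫ ξ, h ξ) := by
        refine mul_le_mul ?_ h2 (norm_nonneg _) (Real.exp_pos _).le
        rw [Complex.norm_exp]
        exact Real.exp_le_exp.2 ((le_abs_self _).trans (hQre x))
    _ = _ := by rw [← mul_assoc, ← Real.exp_add, two_mul]

end Gronwall

section Frame

variable {A₁ A₂ δ lam : ℝ} {m m₁ : ℝ → ℝ} {v w : ℝ → ℂ}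

/-- Replacing a(A) by a(m(x)) changes the coordinate by v·(a(m(x)) - a(A)). This tends to zero
because the two convergent coordinates bound v. -/
theorem tendsto_norm_frame {A : ℝ} {l : Filter ℝ} (hA : 0 < A) (hl : 1 / A < |lam|)
    (hm : Tendsto m l (𝓝 A)) {b c : ℝ}
    (hb : Tendsto (fun x => ‖eigenScale A lam * (eigenRatio A lam * v x - w x)‖) l (𝓝 b))
    (hc : Tendsto (fun x => ‖eigenScale A lam * (eigenRatio A lam * w x - v x)‖) l (𝓝 c)) :
    Tendsto (fun x => ‖eigenScale A lam‖ * ‖eigenRatio (m x) lam * v x - w x‖) l (𝓝 b) := by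
  have h1 := eigenScale_sq_mul hA hl
  have ha : Tendsto (fun x => eigenRatio (m x) lam - eigenRatio A lam) l (𝓝 0) := by
    have h2 : ContinuousAt (fun A : ℝ => eigenRatio A lam) A := by
      unfold eigenRatio
      refine ContinuousAt.div ?_ ?_ (Complex.ofReal_ne_zero.2 hA.ne') <;> fun_prop
    simpa using (h2.tendsto.comp hm).sub_const (eigenRatio A lam)
  have hv : ∀ x, ‖v x‖ ≤ ‖eigenScale A lam‖ *
      (‖eigenScale A lam * (eigenRatio A lam * v x - w x)‖ +
        ‖eigenScale A lam * (eigenRatio A lam * w x - v x)‖) := fun x => by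
    have h3 : v x = eigenScale A lam * (eigenRatio A lam *
        (eigenScale A lam * (eigenRatio A lam * v x - w x)) +
          eigenScale A lam * (eigenRatio A lam * w x - v x)) := by
      linear_combination -v x * h1
    conv_lhs => rw [h3]
    rw [norm_mul]
    refine mul_le_mul_of_nonneg_left ((norm_add_le _ _).trans ?_) (norm_nonneg _)
    rw [norm_mul (eigenRatio A lam), norm_eigenRatio hA hl, one_mul]
  have h4 := (((hb.add hc).const_mul ‖eigenScale A lam‖).mul ha.norm).const_mul ‖eigenScale A lam‖
  rw [norm_zero, mul_zero, mul_zero] at h4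
  refine Tendsto.congr' (f₁ := fun x => ‖eigenScale A lam * (eigenRatio A lam * v x - w x)‖ +
    (‖eigenScale A lam‖ * ‖eigenRatio (m x) lam * v x - w x‖ -
      ‖eigenScale A lam * (eigenRatio A lam * v x - w x)‖))
    (Eventually.of_forall fun x => by ring) ?_
  rw [← add_zero b]
  refine hb.add (squeeze_zero_norm (fun x => ?_) h4)
  rw [norm_mul, ← mul_sub, norm_mul, norm_norm]
  refine mul_le_mul_of_nonneg_left ?_ (norm_nonneg _)
  refine (abs_norm_sub_norm_le _ _).trans ?_
  rw [show eigenRatio (m x) lam * v x - w x - (eigenRatio A lam * v x - w x) =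
    v x * (eigenRatio (m x) lam - eigenRatio A lam) by ring, norm_mul]
  have hvx := hv x
  rw [norm_mul _ (eigenRatio A lam * v x - w x)] at hvx
  exact mul_le_mul_of_nonneg_right hvx (norm_nonneg _)

/-- The coupling of the two components in the frame of instantaneous eigenvectors. -/
def coupling (m m₁ : ℝ → ℝ) (lam x : ℝ) : ℝ :=
  m₁ x / (2 * lam * (m x ^ 2 - 1 / lam ^ 2))

/-- Write a = exp(iφ) with cos φ = 1/(λm). Then a' = iφ'a and a² - 1 = 2ia sin φ, so the quotient is
φ'/(2 sin φ), which is the coupling. -/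
theorem hasDerivAt_eigenRatio {x : ℝ} (hm : HasDerivAt m (m₁ x) x) (hpos : 0 < m x)
    (hl : 1 / m x < |lam|) :
    HasDerivAt (fun x => eigenRatio (m x) lam)
      (coupling m m₁ lam x * (eigenRatio (m x) lam ^ 2 - 1)) x := by
  have hl0 : lam ≠ 0 := ne_zero_of_lt_abs hpos hl
  have hlc : (lam : ℂ) ≠ 0 := Complex.ofReal_ne_zero.2 hl0
  have hmc : (m x : ℂ) ≠ 0 := Complex.ofReal_ne_zero.2 hpos.ne'
  have hR := sub_pos.2 (inv_sq_lt_sq hpos hl)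
  have hy0 := sqrt_pos_of_lt_abs hpos hl
  have hyc : ((√(m x ^ 2 - 1 / lam ^ 2) : ℝ) : ℂ) ≠ 0 := Complex.ofReal_ne_zero.2 hy0.ne'
  have hs := ofReal_sqrt_sq hpos hl
  have hd : HasDerivAt (fun x => √(m x ^ 2 - 1 / lam ^ 2))
      (m x * m₁ x / √(m x ^ 2 - 1 / lam ^ 2)) x := by
    refine (((hm.pow 2).sub_const (1 / lam ^ 2)).sqrt hR.ne').congr_deriv ?_
    simp only [Pi.pow_apply]
    push_cast
    field_simp
  refine (((hd.ofReal_comp.const_mul Complex.I).const_add (1 / (lam : ℂ))).div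
    hm.ofReal_comp hmc).congr_deriv ?_
  have hRc : ((m x : ℂ) ^ 2 - 1 / (lam : ℂ) ^ 2) = ((√(m x ^ 2 - 1 / lam ^ 2) : ℝ) : ℂ) ^ 2 := hs.symm
  rw [coupling, eigenRatio]
  push_cast
  rw [hRc]
  generalize ((√(m x ^ 2 - 1 / lam ^ 2) : ℝ) : ℂ) = y at hs hyc ⊢
  have hI2 := Complex.I_sq
  field_simp at hs ⊢
  linear_combination -m₁ x * (2 * y * lam * Complex.I + 1) * hs - m₁ x * y ^ 2 * lam ^ 2 * hI2

/-- The equations in the frame of instantaneous eigenvectors. -/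
theorem LaxSolution.hasDerivAt_frame (h : LaxSolution m lam v w) {x : ℝ}
    (hm : HasDerivAt m (m₁ x) x) (hpos : 0 < m x) (hl : 1 / m x < |lam|) :
    HasDerivAt (fun x => eigenRatio (m x) lam * v x - w x)
      ((-(Complex.I * (lam * √(m x ^ 2 - 1 / lam ^ 2) / 2)) +
          coupling m m₁ lam x * eigenRatio (m x) lam) * (eigenRatio (m x) lam * v x - w x) +
        coupling m m₁ lam x * (eigenRatio (m x) lam * w x - v x)) x ∧
    HasDerivAt (fun x => eigenRatio (m x) lam * w x - v x)
      ((Complex.I * (lam * √(m x ^ 2 - 1 / lam ^ 2) / 2) +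
          coupling m m₁ lam x * eigenRatio (m x) lam) * (eigenRatio (m x) lam * w x - v x) +
        coupling m m₁ lam x * (eigenRatio (m x) lam * v x - w x)) x := by
  have hlc : (lam : ℂ) ≠ 0 := Complex.ofReal_ne_zero.2 (ne_zero_of_lt_abs hpos hl)
  have hmc : (m x : ℂ) ≠ 0 := Complex.ofReal_ne_zero.2 hpos.ne'
  have hs := ofReal_sqrt_sq hpos hl
  have ha := hasDerivAt_eigenRatio hm hpos hl
  -- `e1` and `e2` express that (a, -1) and (-1, a) are left eigenvectors of the Lax matrix at x;
  -- the derivative of a supplies the remaining terms.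
  have e1 : eigenRatio (m x) lam * lam * m x = 1 + Complex.I * (lam * √(m x ^ 2 - 1 / lam ^ 2)) := by
    rw [eigenRatio]; field_simp
  have e2 : eigenRatio (m x) lam * (1 - Complex.I * (lam * √(m x ^ 2 - 1 / lam ^ 2))) =
      lam * m x := by
    rw [eigenRatio]
    generalize ((√(m x ^ 2 - 1 / lam ^ 2) : ℝ) : ℂ) = y at hs ⊢
    have hI2 := Complex.I_sq
    field_simp at hs ⊢
    linear_combination hs - lam ^ 2 * y ^ 2 * hI2
  constructor
  · refine ((ha.mul (h.deriv_fst x)).sub (h.deriv_snd x)).congr_deriv ?_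
    linear_combination (v x * e2 * (-1 / 2)) + w x / 2 * e1
  · refine ((ha.mul (h.deriv_snd x)).sub (h.deriv_fst x)).congr_deriv ?_
    linear_combination -(v x / 2 * e1) + w x / 2 * e2

end Frame
end
end MCH

/-! ### Bounding c₂₁ by means of a corrector g. -/

namespace MCH

open Set Filter Topology

noncomputable section

variable {A₁ A₂ δ lam : ℝ} {m m₁ : ℝ → ℝ} {v w : ℝ → ℂ}

namespace Profile

theorem continuous (P : Profile A₁ A₂ δ m m₁) : Continuous m :=
  continuous_iff_continuousAt.2 fun x => (P.hasDerivAt x).continuousAt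

theorem m_pos (P : Profile A₁ A₂ δ m m₁) (x : ℝ) : 0 < m x := P.pos.trans_le (P.le x)

theorem one_div_lt_abs (P : Profile A₁ A₂ δ m m₁) {A : ℝ} (hA : δ ≤ A) (hl : 2 / δ ≤ |lam|) :
    1 / A < |lam| := by
  refine (one_div_le_one_div_of_le P.pos hA).trans_lt (lt_of_lt_of_le ?_ hl)
  exact (div_lt_div_iff_of_pos_right P.pos).2 one_lt_two

theorem le_left (P : Profile A₁ A₂ δ m m₁) : δ ≤ A₁ := ge_of_tendsto' P.tendsto_atBot P.le

theorem le_right (P : Profile A₁ A₂ δ m m₁) : δ ≤ A₂ := ge_of_tendsto' P.tendsto_atTop P.le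

theorem inv_sq_le (P : Profile A₁ A₂ δ m m₁) (hl : 2 / δ ≤ |lam|) : 1 / lam ^ 2 ≤ δ ^ 2 / 4 := by
  have hδ := P.pos
  have h0 : 0 < |lam| := (by positivity : 0 < 2 / δ).trans_le hl
  rw [← sq_abs lam, div_le_iff₀ (by positivity)]
  rw [div_le_iff₀ hδ] at hl
  nlinarith [mul_self_le_mul_self (by norm_num) hl]

/-- The threshold 2/δ keeps m² - λ⁻² comparable with m², uniformly in x and λ. -/
theorem three_quarters_le (P : Profile A₁ A₂ δ m m₁) (hl : 2 / δ ≤ |lam|) {A : ℝ} (hA : δ ≤ A) :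
    3 / 4 * A ^ 2 ≤ A ^ 2 - 1 / lam ^ 2 := by
  have h1 := P.inv_sq_le hl
  have h2 : δ ^ 2 ≤ A ^ 2 := pow_le_pow_left₀ P.pos.le hA 2
  linarith

theorem half_le_sqrt (P : Profile A₁ A₂ δ m m₁) (hl : 2 / δ ≤ |lam|) {A : ℝ} (hA : δ ≤ A) :
    A / 2 ≤ √(A ^ 2 - 1 / lam ^ 2) := by
  refine Real.le_sqrt_of_sq_le ?_
  have := P.three_quarters_le hl hA
  nlinarith [sq_nonneg A]

theorem abs_coupling_le (P : Profile A₁ A₂ δ m m₁) (hl : 2 / δ ≤ |lam|) (x : ℝ) :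
    |coupling m m₁ lam x| ≤ |m₁ x| / (|lam| * δ ^ 2) := by
  have hδ := P.pos
  have h0 : 0 < |lam| := (by positivity : 0 < 2 / δ).trans_le hl
  have h1 := P.three_quarters_le hl (P.le x)
  have h2 : δ ^ 2 ≤ m x ^ 2 := pow_le_pow_left₀ P.pos.le (P.le x) 2
  have h3 : 0 < m x ^ 2 - 1 / lam ^ 2 := by nlinarith [pow_pos hδ 2]
  rw [coupling, abs_div, abs_mul, abs_mul, abs_two, abs_of_pos h3]
  refine div_le_div_of_nonneg_left (abs_nonneg _) (by positivity) ?_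
  rw [mul_comm 2, mul_assoc]
  refine mul_le_mul_of_nonneg_left ?_ h0.le
  nlinarith [pow_pos hδ 2]

/-- Gives up the decay in λ, so that the Gronwall constants do not depend on λ. -/
theorem abs_coupling_le' (P : Profile A₁ A₂ δ m m₁) (hl : 2 / δ ≤ |lam|) (x : ℝ) :
    |coupling m m₁ lam x| ≤ |m₁ x| / δ := by
  have hδ := P.pos
  refine (P.abs_coupling_le hl x).trans (div_le_div_of_nonneg_left (abs_nonneg _) hδ ?_)
  rw [div_le_iff₀ hδ] at hl
  nlinarith

theorem continuous_coupling (P : Profile A₁ A₂ δ m m₁) (hl : 2 / δ ≤ |lam|) :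
    Continuous (coupling m m₁ lam) := by
  have hm := P.continuous
  have hm₁ := P.continuous_deriv
  refine hm₁.div (by fun_prop) fun x => ?_
  have := sub_pos.2 (inv_sq_lt_sq (P.m_pos x) (P.one_div_lt_abs (P.le x) hl))
  have h0 := ne_zero_of_lt_abs (P.m_pos x) (P.one_div_lt_abs (P.le x) hl)
  positivity

/-- The imaginary phases drop out of the derivative of |Y|² + |Z|², and the coupling contributes at
most 4|s| times that sum. The limit at -∞ is 1/|κ|² = 2 Im a ≤ 2 with κ = `eigenScale A₁ lam`, hence
the constant 2. -/
theorem norm_frame_sq_le (P : Profile A₁ A₂ δ m m₁) (hl : 2 / δ ≤ |lam|)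
    (h : LaxSolution m lam v w)
    (h1 : Tendsto (fun x => ‖eigenScale A₁ lam * (eigenRatio A₁ lam * v x - w x)‖) atBot (𝓝 1))
    (h2 : Tendsto (fun x => ‖eigenScale A₁ lam * (eigenRatio A₁ lam * w x - v x)‖) atBot (𝓝 0))
    (x : ℝ) :
    ‖eigenRatio (m x) lam * v x - w x‖ ^ 2 + ‖eigenRatio (m x) lam * w x - v x‖ ^ 2 ≤
      2 * Real.exp (∫ ξ, 4 * (|m₁ ξ| / δ)) := by
  have hδ := P.pos
  have hA : 0 < A₁ := hδ.trans_le P.le_left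
  have hlA := P.one_div_lt_abs P.le_left hl
  have hlm := fun x => P.one_div_lt_abs (P.le x) hl
  have hκ := norm_eigenScale_sq_mul hA hlA
  have hκ0 : ‖eigenScale A₁ lam‖ ≠ 0 := fun h => by rw [h] at hκ; norm_num at hκ
  have him : (eigenRatio A₁ lam).im ≤ 1 :=
    (le_abs_self _).trans ((Complex.abs_im_le_norm _).trans (norm_eigenRatio hA hlA).le)
  have hY := (tendsto_norm_frame hA hlA P.tendsto_atBot h1 h2)
  have hZ := (tendsto_norm_frame hA hlA P.tendsto_atBot h2 h1)
  have hN := ((hY.pow 2).add (hZ.pow 2)).const_mul (2 * (eigenRatio A₁ lam).im)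
  have hd := fun x => (h.hasDerivAt_frame (P.hasDerivAt x) (P.m_pos x) (hlm x)).1.norm_sq.add
    (h.hasDerivAt_frame (P.hasDerivAt x) (P.m_pos x) (hlm x)).2.norm_sq
  have hle := le_mul_exp_integral (k := fun ξ => 4 * (|m₁ ξ| / δ))
    (L := 2 * (eigenRatio A₁ lam).im) hd
    (by have := P.continuous_deriv; fun_prop) ((P.integrable_deriv.abs.div_const δ).const_mul 4)
    (fun x => by positivity) (fun x => ?_) ?_ ?_ x
  · exact hle.trans (mul_le_mul_of_nonneg_right (by linarith) (Real.exp_pos _).le)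
  · have hs := P.abs_coupling_le' hl x
    have ha : |(eigenRatio (m x) lam).re| ≤ 1 :=
      (Complex.abs_re_le_norm _).trans (norm_eigenRatio (P.m_pos x) (hlm x)).le
    set Y := eigenRatio (m x) lam * v x - w x
    set Z := eigenRatio (m x) lam * w x - v x
    set a := eigenRatio (m x) lam
    set s := coupling m m₁ lam x
    set y := √(m x ^ 2 - 1 / lam ^ 2)
    have hb : 2 * |Y.re * Z.re + Y.im * Z.im| ≤ ‖Y‖ ^ 2 + ‖Z‖ ^ 2 := by
      rw [← Complex.normSq_eq_norm_sq, ← Complex.normSq_eq_norm_sq, Complex.normSq_apply,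
        Complex.normSq_apply]
      rcases abs_cases (Y.re * Z.re + Y.im * Z.im) with ⟨h, _⟩ | ⟨h, _⟩ <;> rw [h] <;>
        nlinarith [sq_nonneg (Y.re - Z.re), sq_nonneg (Y.im - Z.im), sq_nonneg (Y.re + Z.re),
          sq_nonneg (Y.im + Z.im)]
    have hN0 : 0 ≤ ‖Y‖ ^ 2 + ‖Z‖ ^ 2 := by positivity
    have e1 : s * a.re ≤ |s| := (le_abs_self _).trans
      (by rw [abs_mul]; exact mul_le_of_le_one_right (abs_nonneg _) ha)
    have e2 : 2 * (s * (Y.re * Z.re + Y.im * Z.im)) ≤ |s| * (‖Y‖ ^ 2 + ‖Z‖ ^ 2) := by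
      have := (le_abs_self (s * (Y.re * Z.re + Y.im * Z.im)))
      rw [abs_mul] at this
      nlinarith [mul_le_mul_of_nonneg_left hb (abs_nonneg s)]
    have e3 : 4 * |s| * (‖Y‖ ^ 2 + ‖Z‖ ^ 2) ≤ 4 * (|m₁ x| / δ) * (‖Y‖ ^ 2 + ‖Z‖ ^ 2) :=
      mul_le_mul_of_nonneg_right (by linarith) hN0
    refine le_trans (le_of_eq ?_) (le_trans (add_le_add (add_le_add
      (mul_le_mul_of_nonneg_right e1 hN0) (mul_le_mul_of_nonneg_right e1 hN0))
        (add_le_add e2 e2)) (le_trans (le_of_eq ?_) e3))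
    · rw [← Complex.normSq_eq_norm_sq, ← Complex.normSq_eq_norm_sq, Complex.normSq_apply,
        Complex.normSq_apply]
      simp only [Complex.inner, Complex.mul_re, Complex.mul_im, Complex.add_re, Complex.add_im,
        Complex.conj_re, Complex.conj_im, Complex.neg_re, Complex.neg_im, Complex.I_re,
        Complex.I_im, Complex.ofReal_re, Complex.ofReal_im, Complex.div_ofNat_re,
        Complex.div_ofNat_im]
      ring
    · ring
  · rw [show 2 * (eigenRatio A₁ lam).im = 2 * (eigenRatio A₁ lam).im * (1 ^ 2 + 0 ^ 2) by ring]
    refine hN.congr fun x => ?_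
    simp only [Pi.add_apply]
    linear_combination (‖eigenRatio (m x) lam * v x - w x‖ ^ 2 +
      ‖eigenRatio (m x) lam * w x - v x‖ ^ 2) * hκ
  · rw [eigenRatio_im]; positivity

/-- Z + gY has the same limits in modulus as Z, since g vanishes at both ends and Y is bounded. Its
inhomogeneity contains g only through the expression in `hle`, so r is as small as the L¹ size of
that expression. -/
theorem norm_reflectionCoefficient_le (P : Profile A₁ A₂ δ m m₁)
    (hmi₁ : ∀ x, IntegrableOn (fun ξ => m ξ - A₁) (halfLine .left x))
    (hmi₂ : ∀ x, IntegrableOn (fun ξ => m ξ - A₂) (halfLine .right x)) (hl : 2 / δ ≤ |lam|)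
    {g g₁ : ℝ → ℂ} {h : ℝ → ℝ} (hg : ∀ x, HasDerivAt g (g₁ x) x) (hg₁ : Continuous g₁)
    (hbot : Tendsto g atBot (𝓝 0)) (htop : Tendsto g atTop (𝓝 0)) (hh : Integrable h)
    (hle : ∀ x, ‖coupling m m₁ lam x + g₁ x -
      Complex.I * (lam * √(m x ^ 2 - 1 / lam ^ 2)) * g x‖ +
        ‖g x‖ * |coupling m m₁ lam x| ≤ h x) :
    ‖reflectionCoefficient A₁ A₂ m lam‖ ≤ Real.exp (2 * ∫ ξ, |m₁ ξ| / δ) *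
      ((1 + 2 * Real.exp (∫ ξ, 4 * (|m₁ ξ| / δ))) * ∫ ξ, h ξ) := by
  have hm := P.continuous
  have hδ := P.pos
  have hA₁ : 0 < A₁ := hδ.trans_le P.le_left
  have hA₂ : 0 < A₂ := hδ.trans_le P.le_right
  have hl₁ := P.one_div_lt_abs P.le_left hl
  have hl₂ := P.one_div_lt_abs P.le_right hl
  have hlm := fun x => P.one_div_lt_abs (P.le x) hl
  refine (MCH.norm_reflectionCoefficient_le hA₁ hA₂ hl₁ hl₂ hm hmi₁ hmi₂).trans ?_
  obtain ⟨v, w, hvw, h1, h2, h3, h4⟩ :=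
    exists_laxSolution_tendsto hA₁ hA₂ hl₁ hl₂ hm hmi₁ hmi₂
  set D := 1 + 2 * Real.exp (∫ ξ, 4 * (|m₁ ξ| / δ)) with hD
  have hsq := P.norm_frame_sq_le hl hvw h1 h2
  set Y : ℝ → ℂ := fun x => eigenRatio (m x) lam * v x - w x with hYdef
  set Z : ℝ → ℂ := fun x => eigenRatio (m x) lam * w x - v x with hZdef
  -- By 2t ≤ 1 + t², the constant `D` bounds each coordinate without extracting a square root.
  have hYD : ∀ x, ‖Y x‖ ≤ D := fun x => by
    have := hsq x
    nlinarith [sq_nonneg (‖Y x‖ - 1), sq_nonneg ‖Z x‖, sq_nonneg ‖Y x‖]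
  have hZD : ∀ x, ‖Z x‖ ≤ D := fun x => by
    have := hsq x
    nlinarith [sq_nonneg (‖Z x‖ - 1), sq_nonneg ‖Z x‖, sq_nonneg ‖Y x‖]
  have hYd := fun x => (hvw.hasDerivAt_frame (P.hasDerivAt x) (P.m_pos x) (hlm x)).1
  have hZd := fun x => (hvw.hasDerivAt_frame (P.hasDerivAt x) (P.m_pos x) (hlm x)).2
  have hYc : Continuous Y := continuous_iff_continuousAt.2 fun x => (hYd x).continuousAt
  have hZc : Continuous Z := continuous_iff_continuousAt.2 fun x => (hZd x).continuousAt
  have hgc : Continuous g := continuous_iff_continuousAt.2 fun x => (hg x).continuousAt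
  have hsc := P.continuous_coupling hl
  have hac : Continuous fun x => eigenRatio (m x) lam := continuous_iff_continuousAt.2 fun x =>
    (hasDerivAt_eigenRatio (P.hasDerivAt x) (P.m_pos x) (hlm x)).continuousAt
  have hgY : ∀ {l : Filter ℝ}, Tendsto g l (𝓝 0) → Tendsto (fun x => ‖g x‖ * D) l (𝓝 0) :=
    fun h => by simpa using h.norm.mul_const D
  have hκ₁ := norm_eigenScale_sq_mul hA₁ hl₁
  have hκ₁0 : ‖eigenScale A₁ lam‖ ≠ 0 := fun h => by rw [h] at hκ₁; norm_num at hκ₁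
  have hκ₂ := norm_eigenScale_sq_mul hA₂ hl₂
  have hκ₂le : ‖eigenScale A₂ lam‖ ≤ 1 := by
    have := P.half_le_sqrt hl P.le_right
    have h5 : 1 / 2 ≤ (eigenRatio A₂ lam).im := by
      rw [eigenRatio_im, le_div_iff₀ hA₂]; linarith
    refine (sq_le_one_iff₀ (norm_nonneg _)).1 ?_
    nlinarith [sq_nonneg ‖eigenScale A₂ lam‖]
  have hZ0 : Tendsto (fun x => ‖Z x‖) atBot (𝓝 0) := by
    have := (tendsto_norm_frame hA₁ hl₁ P.tendsto_atBot h2 h1).const_mul ‖eigenScale A₁ lam‖⁻¹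
    rw [mul_zero] at this
    exact this.congr fun x => by rw [← mul_assoc, inv_mul_cancel₀ hκ₁0, one_mul]
  have hT0 : Tendsto (fun x => Z x + g x * Y x) atBot (𝓝 0) := by
    have := hZ0.add (hgY hbot)
    rw [add_zero] at this
    refine squeeze_zero_norm (fun x => (norm_add_le _ _).trans (add_le_add_right ?_ _)) this
    rw [norm_mul]
    exact mul_le_mul_of_nonneg_left (hYD x) (norm_nonneg _)
  set q : ℝ → ℂ := fun x => Complex.I * (lam * √(m x ^ 2 - 1 / lam ^ 2) / 2) +
    coupling m m₁ lam x * eigenRatio (m x) lam with hq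
  set e : ℝ → ℂ := fun x => (coupling m m₁ lam x + g₁ x -
      Complex.I * (lam * √(m x ^ 2 - 1 / lam ^ 2)) * g x) * Y x +
    g x * coupling m m₁ lam x * Z x with he
  have hTd : ∀ x, HasDerivAt (fun x => Z x + g x * Y x) (q x * (Z x + g x * Y x) + e x) x :=
    fun x => by
      refine ((hZd x).add ((hg x).mul (hYd x))).congr_deriv ?_
      simp only [hq, he, hYdef, hZdef]
      ring
  have hbound := norm_le_exp_integral_mul hTd (by fun_prop) (by fun_prop)
    (k := fun x => |m₁ x| / δ) (P.integrable_deriv.abs.div_const δ) (fun x => by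
      have e1 : (q x).re = coupling m m₁ lam x * (eigenRatio (m x) lam).re := by
        simp only [hq, Complex.add_re, Complex.mul_re, Complex.mul_im, Complex.I_re, Complex.I_im,
          Complex.ofReal_re, Complex.ofReal_im, Complex.div_ofNat_re, Complex.div_ofNat_im]
        ring
      rw [e1, abs_mul]
      refine (mul_le_of_le_one_right (abs_nonneg _) ?_).trans (P.abs_coupling_le' hl x)
      exact (Complex.abs_re_le_norm _).trans (norm_eigenRatio (P.m_pos x) (hlm x)).le)
    (hh.const_mul D) (fun x => by
      refine (norm_add_le _ _).trans ?_
      rw [norm_mul, norm_mul, norm_mul, Complex.norm_real, Real.norm_eq_abs]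
      refine le_trans (add_le_add (mul_le_mul_of_nonneg_left (hYD x) (norm_nonneg _))
        (mul_le_mul_of_nonneg_left (hZD x) (by positivity))) ?_
      rw [← add_mul, mul_comm D]
      exact mul_le_mul_of_nonneg_right (hle x) (by positivity)) hT0
  rw [integral_const_mul] at hbound
  set B := Real.exp (2 * ∫ ξ, |m₁ ξ| / δ) * (D * ∫ ξ, h ξ)
  have hlimR : Tendsto (fun x => B + ‖g x‖ * D) atTop (𝓝 B) := by
    simpa using (hgY htop).const_add B
  refine le_of_tendsto_of_tendsto' (tendsto_norm_frame hA₂ hl₂ P.tendsto_atTop h4 h3) hlimR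
    fun x => ?_
  refine (mul_le_of_le_one_left (norm_nonneg _) hκ₂le).trans ?_
  calc ‖Z x‖ = ‖(Z x + g x * Y x) - g x * Y x‖ := by rw [add_sub_cancel_right]
    _ ≤ ‖Z x + g x * Y x‖ + ‖g x * Y x‖ := norm_sub_le _ _
    _ ≤ _ := add_le_add (hbound x) (by
      rw [norm_mul]; exact mul_le_mul_of_nonneg_left (hYD x) (norm_nonneg _))

end Profile
end
end MCH

/-! ### Choice of the corrector for decay of orders two and three. -/

namespace MCH

open Set Filter Topology

noncomputable section

variable {A₁ A₂ δ lam : ℝ} {m m₁ p₁ r₁ : ℝ → ℝ}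

namespace Profile

/-- With y the square root, (m - y)(m + y) = λ⁻². -/
theorem sub_sqrt_mem (P : Profile A₁ A₂ δ m m₁) (hl : 2 / δ ≤ |lam|) (x : ℝ) :
    0 ≤ m x - √(m x ^ 2 - 1 / lam ^ 2) ∧
      m x - √(m x ^ 2 - 1 / lam ^ 2) ≤ 1 / (lam ^ 2 * m x) := by
  have hm := P.m_pos x
  have h3 := P.three_quarters_le hl (P.le x)
  have h0 := ne_zero_of_lt_abs hm (P.one_div_lt_abs (P.le x) hl)
  have hsq := Real.sq_sqrt (show 0 ≤ m x ^ 2 - 1 / lam ^ 2 from le_trans (by positivity) h3)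
  have hy := Real.sqrt_nonneg (m x ^ 2 - 1 / lam ^ 2)
  have he : 0 ≤ 1 / lam ^ 2 := by positivity
  set y := √(m x ^ 2 - 1 / lam ^ 2)
  have h1 : 0 ≤ m x - y := by nlinarith
  refine ⟨h1, ?_⟩
  rw [one_div, mul_inv, ← one_div, ← div_eq_mul_inv, le_div_iff₀ hm]
  nlinarith

/-- Both terms equal m'/(2λm²) to leading order. The quotient m'/m³ is the λ-independent profile for
which multiplication by the phase speed reproduces the coupling up to O(λ⁻³). -/
theorem abs_coupling_sub_le (P : Profile A₁ A₂ δ m m₁) (hl : 2 / δ ≤ |lam|) (x : ℝ) :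
    |coupling m m₁ lam x - √(m x ^ 2 - 1 / lam ^ 2) * (m₁ x / m x ^ 3) / (2 * lam)| ≤
      2 * |m₁ x| / (δ ^ 4 * |lam| ^ 3) := by
  have hm := P.m_pos x
  have hδ := P.pos
  have h3 := P.three_quarters_le hl (P.le x)
  have h0 := ne_zero_of_lt_abs hm (P.one_div_lt_abs (P.le x) hl)
  obtain ⟨hd0, hd⟩ := P.sub_sqrt_mem hl x
  have hsq := Real.sq_sqrt (show 0 ≤ m x ^ 2 - 1 / lam ^ 2 from le_trans (by positivity) h3)
  have hy : 0 < √(m x ^ 2 - 1 / lam ^ 2) :=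
    sqrt_pos_of_lt_abs hm (P.one_div_lt_abs (P.le x) hl)
  rw [coupling]
  rw [← hsq] at h3 ⊢
  rw [Real.sqrt_sq hy.le]
  set y := √(m x ^ 2 - 1 / lam ^ 2)
  have hym : y ≤ m x := by linarith
  have e1 : m₁ x / (2 * lam * y ^ 2) - y * (m₁ x / m x ^ 3) / (2 * lam) =
      m₁ x / (2 * lam) * ((m x - y) * (m x ^ 2 + m x * y + y ^ 2) / (y ^ 2 * m x ^ 3)) := by
    field_simp
    ring
  have e2 : (m x - y) * (m x ^ 2 + m x * y + y ^ 2) / (y ^ 2 * m x ^ 3) ≤ 4 / (lam ^ 2 * δ ^ 4) := by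
    have h4 : (m x - y) * (m x ^ 2 + m x * y + y ^ 2) ≤ 1 / (lam ^ 2 * m x) * (3 * m x ^ 2) :=
      mul_le_mul hd (by nlinarith) (by positivity) (by positivity)
    calc _ ≤ 1 / (lam ^ 2 * m x) * (3 * m x ^ 2) / (3 / 4 * m x ^ 2 * m x ^ 3) :=
          div_le_div₀ (by positivity) h4 (by positivity)
            (mul_le_mul_of_nonneg_right h3 (by positivity))
      _ = 4 / (lam ^ 2 * m x ^ 4) := by field_simp
      _ ≤ _ := by
        have := P.le x
        gcongr
  have e3 : 0 ≤ (m x - y) * (m x ^ 2 + m x * y + y ^ 2) / (y ^ 2 * m x ^ 3) := by positivity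
  rw [e1, abs_mul, abs_div, abs_mul, abs_two, abs_of_nonneg e3]
  calc _ ≤ |m₁ x| / (2 * |lam|) * (4 / (lam ^ 2 * δ ^ 4)) :=
        mul_le_mul_of_nonneg_left e2 (by positivity)
    _ = _ := by
      have : |lam| ≠ 0 := abs_ne_zero.2 h0
      rw [← sq_abs lam]
      field_simp
      norm_num

theorem integrable_div_pow (P : Profile A₁ A₂ δ m m₁) {f : ℝ → ℝ} (hf : Integrable f)
    (n : ℕ) : Integrable fun x => f x / m x ^ n := by
  have hδ := P.pos
  have hm := P.continuous
  simp only [div_eq_mul_inv]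
  refine hf.mul_bdd (c := (δ ^ n)⁻¹)
    ((hm.pow n).inv₀ fun x => pow_ne_zero n (P.m_pos x).ne').aestronglyMeasurable
    (ae_of_all _ fun x => ?_)
  have h1 := P.m_pos x
  have h2 := P.le x
  rw [Real.norm_of_nonneg (by positivity)]
  gcongr

theorem exists_norm_reflectionCoefficient_le_two (P : Profile A₁ A₂ δ m m₁)
    (hmi₁ : ∀ x, IntegrableOn (fun ξ => m ξ - A₁) (halfLine .left x))
    (hmi₂ : ∀ x, IntegrableOn (fun ξ => m ξ - A₂) (halfLine .right x))
    (hp : ∀ x, HasDerivAt (fun x => m₁ x / m x ^ 3) (p₁ x) x) (hp₁ : Continuous p₁)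
    (hpi : Integrable p₁) : ∃ C, ∀ lam : ℝ, 2 / δ ≤ |lam| →
      ‖reflectionCoefficient A₁ A₂ m lam‖ ≤ C * (1 / |lam| ^ 2) := by
  have hδ := P.pos
  set p : ℝ → ℝ := fun x => m₁ x / m x ^ 3 with hpdef
  have hpint : Integrable p := P.integrable_div_pow P.integrable_deriv 3
  have hbot := tendsto_zero_atBot_of_integrable hp hpint hpi
  have htop := tendsto_zero_atTop_of_integrable hp hpint hpi
  have hpc : Continuous p := continuous_iff_continuousAt.2 fun x => (hp x).continuousAt
  obtain ⟨B, hB⟩ := exists_norm_le_of_tendsto_atBot_atTop hpc hbot htop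
  have hB0 : 0 ≤ B := (norm_nonneg _).trans (hB 0)
  refine ⟨Real.exp (2 * ∫ ξ, |m₁ ξ| / δ) * ((1 + 2 * Real.exp (∫ ξ, 4 * (|m₁ ξ| / δ))) *
    ∫ ξ, ((1 / δ ^ 3 + B / (4 * δ)) * |m₁ ξ| + |p₁ ξ| / 2)), fun lam hl => ?_⟩
  have hl0 : 0 < |lam| := (by positivity : 0 < 2 / δ).trans_le hl
  have hlc : (lam : ℂ) ≠ 0 := Complex.ofReal_ne_zero.2 (abs_pos.1 hl0)
  have hinv : 1 / |lam| ≤ δ / 2 := by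
    rw [div_le_div_iff₀ hl0 two_pos]; rw [div_le_iff₀ hδ] at hl; linarith
  have hlim : ∀ {l : Filter ℝ}, Tendsto p l (𝓝 0) →
      Tendsto (fun x => -(Complex.I / 2) / (lam : ℂ) ^ 2 * (p x : ℂ)) l (𝓝 0) := fun h => by
    simpa using ((Complex.continuous_ofReal.tendsto 0).comp h).const_mul
      (-(Complex.I / 2) / (lam : ℂ) ^ 2)
  -- This g balances s against iλ√(m² - λ⁻²) g up to O(λ⁻³); the error of order λ⁻² is g' itself.
  have hmain := P.norm_reflectionCoefficient_le hmi₁ hmi₂ hl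
    (g := fun x => -(Complex.I / 2) / (lam : ℂ) ^ 2 * (p x : ℂ))
    (g₁ := fun x => -(Complex.I / 2) / (lam : ℂ) ^ 2 * (p₁ x : ℂ))
    (h := fun ξ => ((1 / δ ^ 3 + B / (4 * δ)) * |m₁ ξ| + |p₁ ξ| / 2) * (1 / |lam| ^ 2))
    (fun x => (hp x).ofReal_comp.const_mul _) (by fun_prop) (hlim hbot) (hlim htop)
    (((P.integrable_deriv.abs.const_mul _).add (hpi.abs.div_const 2)).mul_const _) (fun x => ?_)
  · rw [integral_mul_const] at hmain
    refine hmain.trans (le_of_eq ?_)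
    ring
  · have h1 := P.abs_coupling_sub_le hl x
    have h2 := P.abs_coupling_le hl x
    have hpB := hB x
    have hc : ‖-(Complex.I / 2) / (lam : ℂ) ^ 2‖ = 1 / (2 * |lam| ^ 2) := by
      rw [norm_div, norm_neg, norm_div, norm_pow, Complex.norm_I, Complex.norm_real,
        Complex.norm_ofNat, Real.norm_eq_abs, div_div]
    have e1 : (coupling m m₁ lam x : ℂ) + -(Complex.I / 2) / (lam : ℂ) ^ 2 * (p₁ x : ℂ) -
        Complex.I * (lam * √(m x ^ 2 - 1 / lam ^ 2)) *
          (-(Complex.I / 2) / (lam : ℂ) ^ 2 * (p x : ℂ)) =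
        ((coupling m m₁ lam x - √(m x ^ 2 - 1 / lam ^ 2) * p x / (2 * lam) : ℝ) : ℂ) +
          -(Complex.I / 2) / (lam : ℂ) ^ 2 * (p₁ x : ℂ) := by
      push_cast
      generalize ((√(m x ^ 2 - 1 / lam ^ 2) : ℝ) : ℂ) = y
      field_simp
      linear_combination lam * y * p x * Complex.I_sq
    rw [e1]
    have e2 : ‖((coupling m m₁ lam x - √(m x ^ 2 - 1 / lam ^ 2) * p x / (2 * lam) : ℝ) : ℂ) +
        -(Complex.I / 2) / (lam : ℂ) ^ 2 * (p₁ x : ℂ)‖ ≤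
        2 * |m₁ x| / (δ ^ 4 * |lam| ^ 3) + 1 / (2 * |lam| ^ 2) * |p₁ x| := by
      refine (norm_add_le _ _).trans (add_le_add ?_ (le_of_eq ?_))
      · rw [Complex.norm_real]; exact h1
      · rw [norm_mul, hc, Complex.norm_real, Real.norm_eq_abs]
    have e3 : ‖-(Complex.I / 2) / (lam : ℂ) ^ 2 * (p x : ℂ)‖ * |coupling m m₁ lam x| ≤
        1 / (2 * |lam| ^ 2) * B * (|m₁ x| / (|lam| * δ ^ 2)) := by
      rw [norm_mul, hc, Complex.norm_real]
      exact mul_le_mul (mul_le_mul_of_nonneg_left hpB (by positivity)) h2 (abs_nonneg _)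
        (by positivity)
    refine (add_le_add e2 e3).trans ?_
    have e4 : 2 * |m₁ x| / (δ ^ 4 * |lam| ^ 3) + 1 / (2 * |lam| ^ 2) * |p₁ x| +
        1 / (2 * |lam| ^ 2) * B * (|m₁ x| / (|lam| * δ ^ 2)) =
        1 / |lam| ^ 2 * (1 / |lam| * (2 / δ ^ 4 * |m₁ x| + B / (2 * δ ^ 2) * |m₁ x|) +
          |p₁ x| / 2) := by
      field_simp
      ring
    have e5 : 1 / |lam| * (2 / δ ^ 4 * |m₁ x| + B / (2 * δ ^ 2) * |m₁ x|) ≤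
        δ / 2 * (2 / δ ^ 4 * |m₁ x| + B / (2 * δ ^ 2) * |m₁ x|) :=
      mul_le_mul_of_nonneg_right hinv (by positivity)
    have e6 : δ / 2 * (2 / δ ^ 4 * |m₁ x| + B / (2 * δ ^ 2) * |m₁ x|) =
        (1 / δ ^ 3 + B / (4 * δ)) * |m₁ x| := by
      field_simp
      ring
    rw [e4, mul_comm]
    exact mul_le_mul_of_nonneg_right (by linarith) (by positivity)

theorem exists_norm_reflectionCoefficient_le_three (P : Profile A₁ A₂ δ m m₁)
    (hmi₁ : ∀ x, IntegrableOn (fun ξ => m ξ - A₁) (halfLine .left x))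
    (hmi₂ : ∀ x, IntegrableOn (fun ξ => m ξ - A₂) (halfLine .right x))
    (hp : ∀ x, HasDerivAt (fun x => m₁ x / m x ^ 3) (p₁ x) x) (hpi : Integrable p₁)
    (hr : ∀ x, HasDerivAt (fun x => p₁ x / m x) (r₁ x) x) (hr₁ : Continuous r₁)
    (hri : Integrable r₁) : ∃ C, ∀ lam : ℝ, 2 / δ ≤ |lam| →
      ‖reflectionCoefficient A₁ A₂ m lam‖ ≤ C * (1 / |lam| ^ 3) := by
  have hδ := P.pos
  set p : ℝ → ℝ := fun x => m₁ x / m x ^ 3 with hpdef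
  set r : ℝ → ℝ := fun x => p₁ x / m x with hrdef
  have hpint : Integrable p := P.integrable_div_pow P.integrable_deriv 3
  have hrint : Integrable r := by simpa using P.integrable_div_pow hpi 1
  have hpbot := tendsto_zero_atBot_of_integrable hp hpint hpi
  have hptop := tendsto_zero_atTop_of_integrable hp hpint hpi
  have hrbot := tendsto_zero_atBot_of_integrable hr hrint hri
  have hrtop := tendsto_zero_atTop_of_integrable hr hrint hri
  have hpc : Continuous p := continuous_iff_continuousAt.2 fun x => (hp x).continuousAt
  have hrc : Continuous r := continuous_iff_continuousAt.2 fun x => (hr x).continuousAt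
  have hp₁ : Continuous p₁ := by
    have : p₁ = fun x => r x * m x := funext fun x => by
      rw [hrdef, div_mul_cancel₀ _ (P.m_pos x).ne']
    rw [this]
    exact hrc.mul P.continuous
  obtain ⟨B, hB⟩ := exists_norm_le_of_tendsto_atBot_atTop hpc hpbot hptop
  obtain ⟨R, hR⟩ := exists_norm_le_of_tendsto_atBot_atTop hrc hrbot hrtop
  have hB0 : 0 ≤ B := (norm_nonneg _).trans (hB 0)
  have hR0 : 0 ≤ R := (norm_nonneg _).trans (hR 0)
  refine ⟨Real.exp (2 * ∫ ξ, |m₁ ξ| / δ) * ((1 + 2 * Real.exp (∫ ξ, 4 * (|m₁ ξ| / δ))) *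
    ∫ ξ, ((2 / δ ^ 4 + B / (2 * δ ^ 2) + R / (4 * δ)) * |m₁ ξ| + |p₁ ξ| / (4 * δ) +
      |r₁ ξ| / 2)), fun lam hl => ?_⟩
  have hl0 : 0 < |lam| := (by positivity : 0 < 2 / δ).trans_le hl
  have hlc : (lam : ℂ) ≠ 0 := Complex.ofReal_ne_zero.2 (abs_pos.1 hl0)
  -- Surplus powers of 1/|λ| are absorbed into the constants, so that the majorant is a fixed
  -- integrable function times λ⁻³.
  have hinv : 1 / |lam| ≤ δ / 2 := by
    rw [div_le_div_iff₀ hl0 two_pos]; rw [div_le_iff₀ hδ] at hl; linarith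
  have hlim : ∀ {l : Filter ℝ}, Tendsto p l (𝓝 0) → Tendsto r l (𝓝 0) →
      Tendsto (fun x => -(Complex.I / 2) / (lam : ℂ) ^ 2 * (p x : ℂ) +
        -(1 / 2) / (lam : ℂ) ^ 3 * (r x : ℂ)) l (𝓝 0) := fun h h' => by
    simpa using (((Complex.continuous_ofReal.tendsto 0).comp h).const_mul
      (-(Complex.I / 2) / (lam : ℂ) ^ 2)).add
      (((Complex.continuous_ofReal.tendsto 0).comp h').const_mul (-(1 / 2) / (lam : ℂ) ^ 3))
  -- The added term with r = p'/m cancels the derivative of the first one, except for the factor m -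
  -- √(m² - λ⁻²) = O(λ⁻²). The new error of order λ⁻³ comes from r'.
  have hmain := P.norm_reflectionCoefficient_le hmi₁ hmi₂ hl
    (g := fun x => -(Complex.I / 2) / (lam : ℂ) ^ 2 * (p x : ℂ) +
      -(1 / 2) / (lam : ℂ) ^ 3 * (r x : ℂ))
    (g₁ := fun x => -(Complex.I / 2) / (lam : ℂ) ^ 2 * (p₁ x : ℂ) +
      -(1 / 2) / (lam : ℂ) ^ 3 * (r₁ x : ℂ))
    (h := fun ξ => ((2 / δ ^ 4 + B / (2 * δ ^ 2) + R / (4 * δ)) * |m₁ ξ| + |p₁ ξ| / (4 * δ) +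
      |r₁ ξ| / 2) * (1 / |lam| ^ 3))
    (fun x => ((hp x).ofReal_comp.const_mul _).add ((hr x).ofReal_comp.const_mul _))
    (by fun_prop) (hlim hpbot hrbot) (hlim hptop hrtop)
    ((((P.integrable_deriv.abs.const_mul _).add (hpi.abs.div_const _)).add
      (hri.abs.div_const 2)).mul_const _) (fun x => ?_)
  · rw [integral_mul_const] at hmain
    refine hmain.trans (le_of_eq ?_)
    ring
  · have h1 := P.abs_coupling_sub_le hl x
    have h2 := P.abs_coupling_le hl x
    have hpB := hB x
    have hrR := hR x
    have hm := P.m_pos x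
    have hmc : (m x : ℂ) ≠ 0 := Complex.ofReal_ne_zero.2 hm.ne'
    obtain ⟨hd0, hd⟩ := P.sub_sqrt_mem hl x
    have hc : ‖-(Complex.I / 2) / (lam : ℂ) ^ 2‖ = 1 / (2 * |lam| ^ 2) := by
      rw [norm_div, norm_neg, norm_div, norm_pow, Complex.norm_I, Complex.norm_real,
        Complex.norm_ofNat, Real.norm_eq_abs, div_div]
    have hc' : ‖-(1 / 2) / (lam : ℂ) ^ 3‖ = 1 / (2 * |lam| ^ 3) := by
      rw [norm_div, norm_neg, norm_div, norm_pow, norm_one, Complex.norm_real,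
        Complex.norm_ofNat, Real.norm_eq_abs, div_div]
    have hrp : (p₁ x : ℂ) = r x * m x := by
      rw [← Complex.ofReal_mul, hrdef, div_mul_cancel₀ _ hm.ne']
    have e1 : (coupling m m₁ lam x : ℂ) + (-(Complex.I / 2) / (lam : ℂ) ^ 2 * (p₁ x : ℂ) +
          -(1 / 2) / (lam : ℂ) ^ 3 * (r₁ x : ℂ)) -
        Complex.I * (lam * √(m x ^ 2 - 1 / lam ^ 2)) *
          (-(Complex.I / 2) / (lam : ℂ) ^ 2 * (p x : ℂ) + -(1 / 2) / (lam : ℂ) ^ 3 * (r x : ℂ)) =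
        ((coupling m m₁ lam x - √(m x ^ 2 - 1 / lam ^ 2) * p x / (2 * lam) : ℝ) : ℂ) +
          -(Complex.I / 2) / (lam : ℂ) ^ 2 *
            (((m x - √(m x ^ 2 - 1 / lam ^ 2)) * r x : ℝ) : ℂ) +
          -(1 / 2) / (lam : ℂ) ^ 3 * (r₁ x : ℂ) := by
      rw [hrp]
      push_cast
      generalize ((√(m x ^ 2 - 1 / lam ^ 2) : ℝ) : ℂ) = y
      field_simp
      linear_combination lam ^ 2 * y * p x * Complex.I_sq
    rw [e1]
    have e7 : |(m x - √(m x ^ 2 - 1 / lam ^ 2)) * r x| ≤ |p₁ x| / (|lam| ^ 2 * δ ^ 2) := by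
      rw [abs_mul, abs_of_nonneg hd0, hrdef, abs_div, abs_of_pos hm, sq_abs]
      calc _ ≤ 1 / (lam ^ 2 * m x) * (|p₁ x| / m x) :=
            mul_le_mul_of_nonneg_right hd (by positivity)
        _ = |p₁ x| / (lam ^ 2 * m x ^ 2) := by
            have : lam ≠ 0 := abs_pos.1 hl0
            field_simp
        _ ≤ _ := by
            have := P.le x
            have : lam ≠ 0 := abs_pos.1 hl0
            gcongr
    have e2 : ‖((coupling m m₁ lam x - √(m x ^ 2 - 1 / lam ^ 2) * p x / (2 * lam) : ℝ) : ℂ) +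
        -(Complex.I / 2) / (lam : ℂ) ^ 2 * (((m x - √(m x ^ 2 - 1 / lam ^ 2)) * r x : ℝ) : ℂ) +
        -(1 / 2) / (lam : ℂ) ^ 3 * (r₁ x : ℂ)‖ ≤
        2 * |m₁ x| / (δ ^ 4 * |lam| ^ 3) + 1 / (2 * |lam| ^ 2) * (|p₁ x| / (|lam| ^ 2 * δ ^ 2)) +
          1 / (2 * |lam| ^ 3) * |r₁ x| := by
      refine (norm_add_le _ _).trans (add_le_add ((norm_add_le _ _).trans (add_le_add ?_ ?_))
        (le_of_eq ?_))
      · rw [Complex.norm_real]; exact h1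
      · rw [norm_mul, hc, Complex.norm_real, Real.norm_eq_abs]
        exact mul_le_mul_of_nonneg_left e7 (by positivity)
      · rw [norm_mul, hc', Complex.norm_real, Real.norm_eq_abs]
    have e3 : ‖-(Complex.I / 2) / (lam : ℂ) ^ 2 * (p x : ℂ) +
          -(1 / 2) / (lam : ℂ) ^ 3 * (r x : ℂ)‖ * |coupling m m₁ lam x| ≤
        (1 / (2 * |lam| ^ 2) * B + 1 / (2 * |lam| ^ 3) * R) * (|m₁ x| / (|lam| * δ ^ 2)) := by
      refine mul_le_mul ((norm_add_le _ _).trans ?_) h2 (abs_nonneg _) (by positivity)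
      rw [norm_mul, norm_mul, hc, hc', Complex.norm_real, Complex.norm_real]
      exact add_le_add (mul_le_mul_of_nonneg_left hpB (by positivity))
        (mul_le_mul_of_nonneg_left hrR (by positivity))
    refine (add_le_add e2 e3).trans ?_
    have e4 : 2 * |m₁ x| / (δ ^ 4 * |lam| ^ 3) +
          1 / (2 * |lam| ^ 2) * (|p₁ x| / (|lam| ^ 2 * δ ^ 2)) + 1 / (2 * |lam| ^ 3) * |r₁ x| +
        (1 / (2 * |lam| ^ 2) * B + 1 / (2 * |lam| ^ 3) * R) * (|m₁ x| / (|lam| * δ ^ 2)) =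
        1 / |lam| ^ 3 * ((2 / δ ^ 4 + B / (2 * δ ^ 2)) * |m₁ x| +
          1 / |lam| * (|p₁ x| / (2 * δ ^ 2) + R / (2 * δ ^ 2) * |m₁ x|) + |r₁ x| / 2) := by
      field_simp
      ring
    have e5 : 1 / |lam| * (|p₁ x| / (2 * δ ^ 2) + R / (2 * δ ^ 2) * |m₁ x|) ≤
        δ / 2 * (|p₁ x| / (2 * δ ^ 2) + R / (2 * δ ^ 2) * |m₁ x|) :=
      mul_le_mul_of_nonneg_right hinv (by positivity)
    have e6 : δ / 2 * (|p₁ x| / (2 * δ ^ 2) + R / (2 * δ ^ 2) * |m₁ x|) =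
        |p₁ x| / (4 * δ) + R / (4 * δ) * |m₁ x| := by
      field_simp
      ring
    rw [e4, mul_comm]
    exact mul_le_mul_of_nonneg_right (by linarith) (by positivity)

end Profile

end

end MCH

/-! ### Integrability of the correctors for step-like data, and the conclusion. -/

namespace MCH

open Set Filter Topology

namespace StepLikeData

variable {A₁ A₂ : ℝ} {N : ℕ} {u : ℝ → ℝ}

/-- Below the top order a derivative of m is integrable with integrable derivative, hence bounded.
This keeps products such as m'², m'm'' and m'³ in L¹. -/
theorem exists_iteratedDeriv_le (h : StepLikeData A₁ A₂ N u) {l : ℕ} (hl0 : 1 ≤ l) (hl : l < N) :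
    ∃ C, ∀ x, ‖iteratedDeriv l (momentum u) x‖ ≤ C := by
  have hi := h.integrable_iteratedDeriv hl0 hl.le
  have hi' := h.integrable_iteratedDeriv (l := l + 1) (Nat.le_add_left 1 l) hl
  have hd := h.hasDerivAt_iteratedDeriv hl
  exact exists_norm_le_of_tendsto_atBot_atTop (h.continuous_iteratedDeriv hl.le)
    (tendsto_zero_atBot_of_integrable hd hi hi') (tendsto_zero_atTop_of_integrable hd hi hi')

theorem integrable_mul_iteratedDeriv (h : StepLikeData A₁ A₂ N u) {l : ℕ} (hl0 : 1 ≤ l)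
    (hl : l < N) {f : ℝ → ℝ} (hf : Integrable f) :
    Integrable fun x => f x * iteratedDeriv l (momentum u) x := by
  obtain ⟨C, hC⟩ := h.exists_iteratedDeriv_le hl0 hl
  exact hf.mul_bdd (c := C) (h.continuous_iteratedDeriv hl.le).aestronglyMeasurable
    (ae_of_all _ hC)

theorem reflectionDefinedAt (h : StepLikeData A₁ A₂ N u) (hA₁ : 0 < A₁) (hA₂ : A₁ < A₂)
    {lam : ℝ} (hl : 1 / A₁ < |lam|) : ReflectionDefinedAt A₁ A₂ (momentum u) lam :=
  MCH.reflectionDefinedAt hA₁ (hA₁.trans hA₂) hl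
    ((one_div_lt_one_div_of_lt hA₁ hA₂).trans hl) h.continuous h.integrableOn_left
    h.integrableOn_right

/-- The cocompact filter of ℝ covers λ → +∞ and λ → -∞ at once. -/
theorem isBigO_of_le {r : ℝ → ℂ} {δ C : ℝ} {N : ℕ}
    (h : ∀ lam : ℝ, 2 / δ ≤ |lam| → ‖r lam‖ ≤ C * (1 / |lam| ^ N)) :
    Asymptotics.IsBigO (cocompact ℝ) r fun lam : ℝ => 1 / lam ^ N := by
  refine Asymptotics.IsBigO.of_bound C ?_
  filter_upwards [(tendsto_norm_cocompact_atTop (E := ℝ)).eventually_ge_atTop (2 / δ)] with lam hl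
  rw [norm_div, norm_one, norm_pow, Real.norm_eq_abs]
  exact h lam hl

theorem hasDerivAt_div_pow {f f' m m' : ℝ → ℝ} (n : ℕ) {x : ℝ} (hf : HasDerivAt f (f' x) x)
    (hm : HasDerivAt m (m' x) x) (h0 : m x ≠ 0) :
    HasDerivAt (fun x => f x / m x ^ n) (f' x / m x ^ n - n * (f x * m' x) / m x ^ (n + 1)) x := by
  refine (hf.div (hm.pow n) (pow_ne_zero n h0)).congr_deriv ?_
  rcases n with _ | n
  · simp
  · simp only [Nat.add_sub_cancel, Pi.pow_apply]
    field_simp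
    ring

theorem isBigO_two (h : StepLikeData A₁ A₂ 2 u) (hA₁ : 0 < A₁) (hA₂ : 0 < A₂) :
    Asymptotics.IsBigO (cocompact ℝ)
      (fun lam : ℝ => reflectionCoefficient A₁ A₂ (momentum u) lam)
      (fun lam : ℝ => 1 / lam ^ 2) := by
  obtain ⟨δ, P⟩ := h.exists_profile one_le_two hA₁ hA₂
  have hm := h.continuous
  have hm0 := fun x => (P.m_pos x).ne'
  have h1 := h.continuous_iteratedDeriv (l := 1) one_le_two
  have h2 := h.continuous_iteratedDeriv (l := 2) le_rfl
  obtain ⟨C, hC⟩ := P.exists_norm_reflectionCoefficient_le_two h.integrableOn_left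
    h.integrableOn_right
    (fun x => hasDerivAt_div_pow 3 (h.hasDerivAt_iteratedDeriv one_lt_two x) (P.hasDerivAt x)
      (hm0 x))
    ((h2.div (hm.pow 3) fun x => pow_ne_zero _ (hm0 x)).sub
      ((continuous_const.mul (h1.mul h1)).div (hm.pow 4) fun x => pow_ne_zero _ (hm0 x)))
    ((P.integrable_div_pow (h.integrable_iteratedDeriv one_le_two le_rfl) 3).sub
      (P.integrable_div_pow ((h.integrable_mul_iteratedDeriv le_rfl one_lt_two
        P.integrable_deriv).const_mul _) 4))
  exact isBigO_of_le hC

theorem isBigO_three (h : StepLikeData A₁ A₂ 3 u) (hA₁ : 0 < A₁) (hA₂ : 0 < A₂) :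
    Asymptotics.IsBigO (cocompact ℝ)
      (fun lam : ℝ => reflectionCoefficient A₁ A₂ (momentum u) lam)
      (fun lam : ℝ => 1 / lam ^ 3) := by
  obtain ⟨δ, P⟩ := h.exists_profile (by norm_num) hA₁ hA₂
  have hm := h.continuous
  have hm0 := fun x => (P.m_pos x).ne'
  have h1 := h.continuous_iteratedDeriv (l := 1) (by norm_num)
  have h2 := h.continuous_iteratedDeriv (l := 2) (by norm_num)
  have h3 := h.continuous_iteratedDeriv (l := 3) le_rfl
  have d1 := h.hasDerivAt_iteratedDeriv (l := 1) (by norm_num)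
  have d2 := h.hasDerivAt_iteratedDeriv (l := 2) (by norm_num)
  have i2 := h.integrable_iteratedDeriv (l := 2) (by norm_num) (by norm_num)
  have i3 := h.integrable_iteratedDeriv (l := 3) (by norm_num) le_rfl
  set m := momentum u
  set m₁ := iteratedDeriv 1 m
  set m₂ := iteratedDeriv 2 m
  set m₃ := iteratedDeriv 3 m
  have hmul : ∀ {f : ℝ → ℝ}, Integrable f → Integrable fun x => f x * m₁ x := fun hf =>
    h.integrable_mul_iteratedDeriv le_rfl (by norm_num) hf
  have i11 := hmul P.integrable_deriv
  -- Natural-number casts and exponents such as `3 + 1` keep the exact shape that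
  -- `hasDerivAt_div_pow` produces, so the pieces unify without rewriting.
  have hpi : Integrable fun x => m₂ x / m x ^ 3 - (3 : ℕ) * (m₁ x * m₁ x) / m x ^ (3 + 1) :=
    (P.integrable_div_pow i2 3).sub (P.integrable_div_pow (i11.const_mul _) 4)
  have hp : ∀ x, HasDerivAt (fun x => m₂ x / m x ^ 3 - (3 : ℕ) * (m₁ x * m₁ x) / m x ^ (3 + 1))
      (m₃ x / m x ^ 3 - (3 : ℕ) * (m₂ x * m₁ x) / m x ^ (3 + 1) -
        ((3 : ℕ) * (m₂ x * m₁ x + m₁ x * m₂ x) / m x ^ 4 -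
          (4 : ℕ) * ((3 : ℕ) * (m₁ x * m₁ x) * m₁ x) / m x ^ (4 + 1))) x := fun x =>
    (hasDerivAt_div_pow 3 (d2 x) (P.hasDerivAt x) (hm0 x)).sub
      (hasDerivAt_div_pow (f := fun x => (3 : ℕ) * (m₁ x * m₁ x))
        (f' := fun x => (3 : ℕ) * (m₂ x * m₁ x + m₁ x * m₂ x)) 4
        (((d1 x).mul (d1 x)).const_mul _) (P.hasDerivAt x) (hm0 x))
  have hr := fun x => hasDerivAt_div_pow (f' := fun x =>
      m₃ x / m x ^ 3 - (3 : ℕ) * (m₂ x * m₁ x) / m x ^ (3 + 1) -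
        ((3 : ℕ) * (m₂ x * m₁ x + m₁ x * m₂ x) / m x ^ 4 -
          (4 : ℕ) * ((3 : ℕ) * (m₁ x * m₁ x) * m₁ x) / m x ^ (4 + 1)))
    (n := 1) (hp x) (P.hasDerivAt x) (hm0 x)
  simp only [pow_one] at hr
  have i21 := hmul i2
  have i12 : Integrable fun x => m₁ x * m₂ x := i21.congr (ae_of_all _ fun x => mul_comm _ _)
  obtain ⟨C, hC⟩ := P.exists_norm_reflectionCoefficient_le_three h.integrableOn_left
    h.integrableOn_right
    (fun x => hasDerivAt_div_pow 3 (d1 x) (P.hasDerivAt x) (hm0 x)) hpi hr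
    (by fun_prop (disch := exact fun x => by first | exact hm0 x | exact pow_ne_zero _ (hm0 x)))
    (by
      have j1 := ((P.integrable_div_pow i3 3).sub (P.integrable_div_pow (i21.const_mul (3 : ℕ)) 4)).sub
        ((P.integrable_div_pow ((i21.add i12).const_mul (3 : ℕ)) 4).sub
          (P.integrable_div_pow ((hmul (i11.const_mul (3 : ℕ))).const_mul (4 : ℕ)) 5))
      have j2 := (P.integrable_div_pow j1 1).sub
        (P.integrable_div_pow ((hmul hpi).const_mul (1 : ℕ)) 2)
      simp only [pow_one] at j2
      exact j2)
  exact isBigO_of_le hC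

end StepLikeData

end MCH

theorem mainTheorem6 (A₁ A₂ : ℝ) (hA₁ : 0 < A₁) (hA₂ : A₁ < A₂) (u₀ : ℝ → ℝ) :
    (MCH.StepLikeData A₁ A₂ 2 u₀ →
      (∀ lam : ℝ, 1 / A₁ < |lam| →
        MCH.ReflectionDefinedAt A₁ A₂ (MCH.momentum u₀) lam) ∧
      Asymptotics.IsBigO (Filter.cocompact ℝ)
        (fun lam : ℝ => MCH.reflectionCoefficient A₁ A₂ (MCH.momentum u₀) lam)
        (fun lam : ℝ => 1 / lam ^ 2)) ∧
    (MCH.StepLikeData A₁ A₂ 3 u₀ →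
      (∀ lam : ℝ, 1 / A₁ < |lam| →
        MCH.ReflectionDefinedAt A₁ A₂ (MCH.momentum u₀) lam) ∧
      Asymptotics.IsBigO (Filter.cocompact ℝ)
        (fun lam : ℝ => MCH.reflectionCoefficient A₁ A₂ (MCH.momentum u₀) lam)
        (fun lam : ℝ => 1 / lam ^ 3)) :=
  ⟨fun h => ⟨fun _ hl => h.reflectionDefinedAt hA₁ hA₂ hl, h.isBigO_two hA₁ (hA₁.trans hA₂)⟩,
    fun h => ⟨fun _ hl => h.reflectionDefinedAt hA₁ hA₂ hl, h.isBigO_three hA₁ (hA₁.trans hA₂)⟩⟩
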